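/- Let $\mathcal{E}$ be an ellipse that is not a circle, and let $\mathcal{E}_c$ be an ellipse (possibly a circle) lying strictly inside $\mathcal{E}$. Suppose that the pair admits Poncelet triangles, and let $\mathcal{T}$ be the family of all of them, i.e. of all nondegenerate triangles $ABC$ inscribed in $\mathcal{E}$ whose three side lines are tangent to $\mathcal{E}_c$. Let $\mathcal{R}$ be the region swept by the circumcircle, i.e. the union of the circumcircles (as curves) of the triangles in $\mathcal{T}$. Let $\mathcal{K}$ be a circle with center $O$ and radius $r>0$. For $ABC\in\mathcal{T}$ let $A'B'C'$ be the inversive triangle, whose vertices are the inverses of $A,B,C$ with respect to $\mathcal{K}$, and let $X_3'$ be its circumcenter. Let $\mathcal{L}_3'$ be the locus of $X_3'$, i.e. the set of all such points, as $ABC$ ranges over the triangles of $\mathcal{T}$ for which $O$ is not a vertex and $A',B',C'$ are not collinear. Then: (i) if $O$ is exterior to $\mathcal{R}$ (in the interior of its complement), then $\mathcal{L}_3'$ is an ellipse (possibly a circle); (ii) if $O$ is in the interior of $\mathcal{R}$, then $\mathcal{L}_3'$ is a hyperbola; (iii) if $O$ is on the boundary $\partial\mathcal{R}$, then $\mathcal{L}_3'$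 is a parabola. In each case $\mathcal{L}_3'$ is the whole conic in the Euclidean plane. -/

import Mathlib

open scoped ComplexConjugate

/-! The Euclidean plane is `ℂ` with its standard real inner product. -/

noncomputable section

/-- Coordinates of `z` (as real and imaginary part) in the orthonormal frame with origin `c`
whose first axis points along the unit vector `u` and whose second axis points along `i u`. -/
def frameCoord (c u z : ℂ) : ℂ := (z - c) * conj u

/-- A nondegenerate ellipse (circles included): centre, unit direction of the first axis,
and the two semiaxes, in either order of size. -/
structure PlaneEllipse where
  center : ℂ
  dir : ℂ
  a : ℝ
  b : ℝ
  norm_dir : ‖dir‖ = 1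
  a_pos : 0 < a
  b_pos : 0 < b

namespace PlaneEllipse

/-- The quadratic expression `(x/a)² + (y/b)²` in the coordinates of the axes. -/
def form (E : PlaneEllipse) (z : ℂ) : ℝ :=
  ((frameCoord E.center E.dir z).re / E.a) ^ 2 + ((frameCoord E.center E.dir z).im / E.b) ^ 2

/-- The ellipse itself, as a curve. -/
def curve (E : PlaneEllipse) : Set ℂ := {z | E.form z = 1}

/-- The open region bounded by the ellipse. -/
def inside (E : PlaneEllipse) : Set ℂ := {z | E.form z < 1}

/-- The ellipse is a circle. -/
def IsCircle (E : PlaneEllipse) : Prop := E.a = E.b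

/-- `Ec` is nested in `E`: it lies in the open region bounded by `E`. -/
def NestedIn (Ec E : PlaneEllipse) : Prop := Ec.curve ⊆ E.inside

/-- The line `ℓ` is tangent to the ellipse: it meets it in exactly one point. -/
def IsTangentLine (E : PlaneEllipse) (ℓ : AffineSubspace ℝ ℂ) : Prop :=
  ∃! z : ℂ, z ∈ ℓ ∧ z ∈ E.curve

end PlaneEllipse

/-- The triangles inscribed in `E` whose three side lines are tangent to `Ec`. -/
def ponceletFamily (E Ec : PlaneEllipse) : Set (Affine.Triangle ℝ ℂ) :=
  {T | (∀ i, T.points i ∈ E.curve) ∧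
    ∀ i j, i ≠ j → Ec.IsTangentLine (line[ℝ, T.points i, T.points j])}

/-- The region swept by the circumcircle: the union of the circumcircles (as curves)
of the triangles of the family. -/
def circumcircleRegion (E Ec : PlaneEllipse) : Set ℂ :=
  {P | ∃ T ∈ ponceletFamily E Ec, P ∈ T.circumsphere}

/-- `T'` is the inversive triangle of `T` with respect to the circle with centre `O` and
radius `r`: no vertex of `T` is the centre, and the vertices of `T'` are the inverses of
those of `T`. (That `T'` is a nondegenerate triangle is part of its type.) -/
def IsInversiveTriangle (O : ℂ) (r : ℝ) (T T' : Affine.Triangle ℝ ℂ) : Prop :=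
  ∀ i, T.points i ≠ O ∧ T'.points i = EuclideanGeometry.inversion O r (T.points i)

/-- The locus of the circumcentre of the inversive triangle over the family. -/
def inversiveCircumcenterLocus (E Ec : PlaneEllipse) (O : ℂ) (r : ℝ) : Set ℂ :=
  {X | ∃ T ∈ ponceletFamily E Ec, ∃ T' : Affine.Triangle ℝ ℂ,
    IsInversiveTriangle O r T T' ∧ X = T'.circumcenter}

/-- The set is a whole ellipse (possibly a circle). -/
def IsEllipse (S : Set ℂ) : Prop := ∃ E : PlaneEllipse, S = E.curve

/-- The set is a whole hyperbola (both branches): `(x/a)² - (y/b)² = 1` in some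
orthonormal frame. -/
def IsHyperbola (S : Set ℂ) : Prop :=
  ∃ (c u : ℂ) (a b : ℝ), ‖u‖ = 1 ∧ 0 < a ∧ 0 < b ∧
    S = {z | ((frameCoord c u z).re / a) ^ 2 - ((frameCoord c u z).im / b) ^ 2 = 1}

/-- The set is a whole parabola: `y = k x²` with `k > 0` in some orthonormal frame. -/
def IsParabola (S : Set ℂ) : Prop :=
  ∃ (c u : ℂ) (k : ℝ), ‖u‖ = 1 ∧ 0 < k ∧
    S = {z | (frameCoord c u z).im = k * (frameCoord c u z).re ^ 2}

end

/-!
The outer ellipse `E` is the image of the unit circle under a real affine map `PlaneEllipse.param`,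
and in the same coordinate the inner ellipse is `m + α l + β conj l`, `‖l‖ = 1`. The chord of the
unit circle through `z` and `w` touches the inner ellipse when a symmetric polynomial `chordForm`,
quadratic in each of `z` and `w`, vanishes. Vieta's formulas then show that the Poncelet triangles
are the root sets of the cubics

`z³ - (s + l conj t) z² + (t + l conj s) z - l`, `‖l‖ = 1`,

where `s` and `t` are the sum and the product of the foci `f`, `g` of the inner ellipse
(`vieta_of_chordForm`, `chordForm_of_vieta`). Conversely, since `f` and `g` lie in the unit disk,
every `l` on the unit circle gives three points of the unit circle
(`norm_eq_one_of_blaschke`). They are distinct because a double root would be a point where the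
tangent of the unit circle touches the inner ellipse (`chordForm_self_ne_zero`).

The centre of the circumcircle depends on `l` in a real affine way, and there is a point `Q`, inside
`E`, whose power `q` with respect to all the circumcircles is the same negative number
(`netPower_param_eq_zero`, `exists_circumcircle_net`). So the circumcircles are the circles with
centres `c(l)` on an ellipse and power `q` at `Q`. The rest of the argument uses only this.

Write `P = O - Q` and let `p(l) = |P|² - 2⟨P, c(l)⟩ + q` be the power of `O`, with `c(l)` measured
from `Q`. It is a real affine function `k₀ + k · l` of `l`, not identically zero, so it has no, one
or two zeros on the unit circle according to the sign of `netDisc = k₀² - |k|²`, and the region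
swept by the circumcircles is `netDisc ≤ 0`. The inversive triangle has circumcentre
`O + r² (c(l) - P) / p(l)`, and it exists exactly when `p(l) ≠ 0`
(`exists_isInversiveTriangle_iff`). Since `Y = (c - P) / p` satisfies `p (1 + 2⟨P, Y⟩) = q - |P|²`,
the parameter `l` can be recovered rationally from `Y`, and the locus is a whole conic. Its
determinant is nonzero because `q < |P|²`, and its minor has the sign of `netDisc`
(`exists_conicForm_eq_locus`).

It remains to see that `netDisc` is nonzero in the interior of the region. Along the ray
`Q + t P` one has `|k| = t |k(1)|` and `k₀ = t² |P|² - t b + q`. If `k₀ = ± |k|` at `t = 1`, then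
`k₀ ∓ |k| = (t - 1) (t |P|² - q)`, which changes sign at `t = 1`
(`notMem_interior_netRegion`).
-/

noncomputable section

/-! ### Conics given by an equation -/

/-- The general quadratic polynomial `α x² + 2β x y + γ y² + 2δ x + 2ε y + φ` at `z = x + i y`. -/
def conicForm (α β γ δ ε φ : ℝ) (z : ℂ) : ℝ :=
  α * z.re ^ 2 + 2 * β * z.re * z.im + γ * z.im ^ 2 + 2 * δ * z.re + 2 * ε * z.im + φ

/-- The determinant of the symmetric `3 × 3` matrix of `conicForm`; it vanishes exactly for
degenerate conics. -/
def conicDet (α β γ δ ε φ : ℝ) : ℝ :=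
  α * (γ * φ - ε ^ 2) - β * (β * φ - ε * δ) + δ * (β * ε - γ * δ)

lemma norm_eq_one_iff_re_im (u : ℂ) : ‖u‖ = 1 ↔ u.re ^ 2 + u.im ^ 2 = 1 := by
  rw [← sq_eq_sq₀ (norm_nonneg u) zero_le_one, Complex.sq_norm, Complex.normSq_apply]
  constructor <;> intro h <;> linarith

lemma exists_norm_one_sq_eq {v : ℂ} (hv : ‖v‖ = 1) : ∃ u : ℂ, ‖u‖ = 1 ∧ u ^ 2 = v := by
  obtain ⟨u, hu⟩ := IsAlgClosed.exists_pow_nat_eq v (n := 2) (by norm_num)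
  refine ⟨u, ?_, hu⟩
  have : ‖u‖ ^ 2 = 1 := by rw [← norm_pow, hu, hv]
  nlinarith [norm_nonneg u]

/-- Every quadratic polynomial has principal axes: a rotation removes the mixed term. Both the
minor `αγ - β²` and the determinant are unchanged. -/
lemma exists_principal_axes (α β γ δ ε φ : ℝ) :
    ∃ (u : ℂ) (α' γ' δ' ε' : ℝ), ‖u‖ = 1 ∧
      (∀ z, conicForm α β γ δ ε φ z = conicForm α' 0 γ' δ' ε' φ (z * conj u)) ∧
      α' * γ' = α * γ - β ^ 2 ∧
      conicDet α' 0 γ' δ' ε' φ = conicDet α β γ δ ε φ := by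
  -- The mixed coefficient in the frame of `u` is the imaginary part of `τ * conj (u²)`.
  obtain ⟨u, hu, hcross⟩ : ∃ u : ℂ, ‖u‖ = 1 ∧
      β * (u.re ^ 2 - u.im ^ 2) - (α - γ) * u.re * u.im = 0 := by
    set τ : ℂ := ⟨(α - γ) / 2, β⟩ with hτ
    by_cases h0 : τ = 0
    · refine ⟨1, by simp, ?_⟩
      have : β = 0 := by simpa [hτ] using congrArg Complex.im h0
      simp [this]
    · have hn : ‖τ‖ ≠ 0 := norm_ne_zero_iff.mpr h0
      obtain ⟨u, hu, hsq⟩ := exists_norm_one_sq_eq (v := τ / (‖τ‖ : ℂ)) (by simp [hn])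
      refine ⟨u, hu, ?_⟩
      have hmul : (‖τ‖ : ℂ) * u ^ 2 = τ := by
        rw [hsq, mul_div_cancel₀]; exact_mod_cast hn
      have hre : ‖τ‖ * (u.re ^ 2 - u.im ^ 2) = (α - γ) / 2 := by
        have := congrArg Complex.re hmul
        simp [pow_two] at this
        rw [hτ] at this ⊢; simp only at this; nlinarith
      have him : ‖τ‖ * (2 * u.re * u.im) = β := by
        have := congrArg Complex.im hmul
        simp [pow_two] at this
        rw [hτ] at this ⊢; simp only at this; nlinarith
      have h1 : α - γ = 2 * (‖τ‖ * (u.re ^ 2 - u.im ^ 2)) := by linarith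
      rw [h1]; nth_rewrite 1 [← him]; ring
  have hu' := (norm_eq_one_iff_re_im u).mp hu
  refine ⟨u, α * u.re ^ 2 + 2 * β * u.re * u.im + γ * u.im ^ 2,
    α * u.im ^ 2 - 2 * β * u.re * u.im + γ * u.re ^ 2,
    δ * u.re + ε * u.im, ε * u.re - δ * u.im, hu, fun z => ?_, ?_, ?_⟩
  · have hx : z.re = u.re * (z * conj u).re - u.im * (z * conj u).im := by
      simp only [Complex.mul_re, Complex.mul_im, Complex.conj_re, Complex.conj_im]
      linear_combination (-z.re) * hu'
    have hy : z.im = u.im * (z * conj u).re + u.re * (z * conj u).im := by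
      simp only [Complex.mul_re, Complex.mul_im, Complex.conj_re, Complex.conj_im]
      linear_combination (-z.im) * hu'
    generalize z * conj u = w at hx hy
    simp only [conicForm, hx, hy]
    linear_combination (2 * w.re * w.im) * hcross
  · linear_combination (α * γ - β ^ 2) * (u.re ^ 2 + u.im ^ 2 + 1) * hu' +
      (β * (u.re ^ 2 - u.im ^ 2) - (α - γ) * u.re * u.im) * hcross
  · simp only [conicDet]
    linear_combination
      (α * (γ * φ - ε ^ 2) - β * (β * φ - ε * δ) + δ * (β * ε - γ * δ)) *
        (u.re ^ 2 + u.im ^ 2 + 1) * hu' +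
      ((β * (u.re ^ 2 - u.im ^ 2) - (α - γ) * u.re * u.im) * φ -
        2 * (δ * u.re + ε * u.im) * (ε * u.re - δ * u.im)) * hcross

/-- A nonempty nondegenerate conic with positive minor is an ellipse. -/
lemma isEllipse_conicForm {α β γ δ ε φ : ℝ} (hminor : 0 < α * γ - β ^ 2)
    (hdet : conicDet α β γ δ ε φ ≠ 0) (hne : ∃ z, conicForm α β γ δ ε φ z = 0) :
    IsEllipse {z | conicForm α β γ δ ε φ z = 0} := by
  obtain ⟨u, α', γ', δ', ε', hu, hform, hmin, hd⟩ := exists_principal_axes α β γ δ ε φ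
  rw [← hd] at hdet
  rw [← hmin] at hminor
  have hα : α' ≠ 0 := by rintro rfl; simp at hminor
  have hγ : γ' ≠ 0 := by rintro rfl; simp at hminor
  have huc : u * conj u = 1 := by rw [Complex.mul_conj, Complex.normSq_eq_norm_sq, hu]; simp
  set K : ℝ := δ' ^ 2 / α' + ε' ^ 2 / γ' - φ with hK
  have hK0 : K ≠ 0 := by
    intro h
    apply hdet
    have : conicDet α' 0 γ' δ' ε' φ = -(α' * γ') * K := by
      rw [hK, conicDet]; field_simp; ring
    rw [this, h, mul_zero]
  have key : ∀ w : ℂ, conicForm α' 0 γ' δ' ε' φ w =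
      α' * (w.re + δ' / α') ^ 2 + γ' * (w.im + ε' / γ') ^ 2 - K := by
    intro w; rw [hK, conicForm]; field_simp; ring
  have hKα : 0 < K / α' ∧ 0 < K / γ' := by
    obtain ⟨z, hz⟩ := hne
    rw [hform, key] at hz
    have hKe : K = α' * ((z * conj u).re + δ' / α') ^ 2 + γ' * ((z * conj u).im + ε' / γ') ^ 2 := by
      linarith
    have hr : 0 < γ' / α' := by
      rw [show γ' / α' = α' * γ' / α' ^ 2 by field_simp]; positivity
    have h1 : K / α' = ((z * conj u).re + δ' / α') ^ 2 +
        γ' / α' * ((z * conj u).im + ε' / γ') ^ 2 := by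
      rw [hKe]; field_simp
    have h2 : 0 < K / α' := lt_of_le_of_ne (by rw [h1]; positivity) (div_ne_zero hK0 hα).symm
    refine ⟨h2, ?_⟩
    rw [show K / γ' = K / α' / (γ' / α') by field_simp]
    positivity
  refine ⟨⟨u * ⟨-(δ' / α'), -(ε' / γ')⟩, u, √(K / α'), √(K / γ'), hu,
    Real.sqrt_pos.mpr hKα.1, Real.sqrt_pos.mpr hKα.2⟩, ?_⟩
  ext z
  have hfc : frameCoord (u * ⟨-(δ' / α'), -(ε' / γ')⟩) u z = z * conj u + ⟨δ' / α', ε' / γ'⟩ := by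
    have : (⟨-(δ' / α'), -(ε' / γ')⟩ : ℂ) = -⟨δ' / α', ε' / γ'⟩ := by
      apply Complex.ext <;> simp
    rw [frameCoord, this]; linear_combination (⟨δ' / α', ε' / γ'⟩ : ℂ) * huc
  simp only [Set.mem_ofPred_eq, PlaneEllipse.curve, PlaneEllipse.form, hfc, hform z, key,
    div_pow, Real.sq_sqrt hKα.1.le, Real.sq_sqrt hKα.2.le, Complex.add_re, Complex.add_im]
  generalize (z * conj u).re + δ' / α' = x
  generalize (z * conj u).im + ε' / γ' = y
  rw [show x ^ 2 / (K / α') + y ^ 2 / (K / γ') = (α' * x ^ 2 + γ' * y ^ 2) / K by field_simp,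
    div_eq_one_iff_eq hK0, sub_eq_zero]

lemma isHyperbola_of_axes {u : ℂ} (hu : ‖u‖ = 1) {α γ δ ε φ : ℝ} {K : ℝ}
    (hα : α ≠ 0) (hγ : γ ≠ 0)
    (hK : K = δ ^ 2 / α + ε ^ 2 / γ - φ) (hKα : 0 < K / α) (hKγ : K / γ < 0) :
    IsHyperbola {z | conicForm α 0 γ δ ε φ (z * conj u) = 0} := by
  have huc : u * conj u = 1 := by rw [Complex.mul_conj, Complex.normSq_eq_norm_sq, hu]; simp
  have hK0 : K ≠ 0 := by rintro rfl; simp at hKα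
  have hKγ' : 0 < -(K / γ) := by linarith
  refine ⟨u * ⟨-(δ / α), -(ε / γ)⟩, u, √(K / α), √(-(K / γ)), hu,
    Real.sqrt_pos.mpr hKα, Real.sqrt_pos.mpr hKγ', ?_⟩
  have key : ∀ w : ℂ, conicForm α 0 γ δ ε φ w =
      α * (w.re + δ / α) ^ 2 + γ * (w.im + ε / γ) ^ 2 - K := by
    intro w; rw [hK, conicForm]; field_simp; ring
  ext z
  have hfc : frameCoord (u * ⟨-(δ / α), -(ε / γ)⟩) u z = z * conj u + ⟨δ / α, ε / γ⟩ := by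
    have : (⟨-(δ / α), -(ε / γ)⟩ : ℂ) = -⟨δ / α, ε / γ⟩ := by
      apply Complex.ext <;> simp
    rw [frameCoord, this]; linear_combination (⟨δ / α, ε / γ⟩ : ℂ) * huc
  simp only [Set.mem_ofPred_eq, hfc, key,
    div_pow, Real.sq_sqrt hKα.le, Real.sq_sqrt hKγ'.le, Complex.add_re, Complex.add_im]
  generalize (z * conj u).re + δ / α = x
  generalize (z * conj u).im + ε / γ = y
  rw [show x ^ 2 / (K / α) - y ^ 2 / (-(K / γ)) = (α * x ^ 2 + γ * y ^ 2) / K by field_simp; ring,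
    div_eq_one_iff_eq hK0, sub_eq_zero]

/-- Turning the frame by a right angle exchanges the two axes. -/
lemma conicForm_quarter_turn (α γ δ ε φ : ℝ) (u z : ℂ) :
    conicForm α 0 γ δ ε φ (z * conj u) =
      conicForm γ 0 α ε (-δ) φ (z * conj (Complex.I * u)) := by
  have h : z * conj (Complex.I * u) = -Complex.I * (z * conj u) := by
    simp only [map_mul, Complex.conj_I]; ring
  rw [h]
  generalize z * conj u = w
  simp [conicForm]; ring

/-- A nondegenerate conic with negative minor is a hyperbola. -/
lemma isHyperbola_conicForm {α β γ δ ε φ : ℝ} (hminor : α * γ - β ^ 2 < 0)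
    (hdet : conicDet α β γ δ ε φ ≠ 0) :
    IsHyperbola {z | conicForm α β γ δ ε φ z = 0} := by
  obtain ⟨u, α', γ', δ', ε', hu, hform, hmin, hd⟩ := exists_principal_axes α β γ δ ε φ
  rw [← hd] at hdet
  rw [← hmin] at hminor
  have hα : α' ≠ 0 := by rintro rfl; simp at hminor
  have hγ : γ' ≠ 0 := by rintro rfl; simp at hminor
  set K : ℝ := δ' ^ 2 / α' + ε' ^ 2 / γ' - φ with hK
  have hK0 : K ≠ 0 := by
    intro h
    apply hdet
    have : conicDet α' 0 γ' δ' ε' φ = -(α' * γ') * K := by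
      rw [hK, conicDet]; field_simp; ring
    rw [this, h, mul_zero]
  have hprod : K / α' * (K / γ') < 0 := by
    rw [show K / α' * (K / γ') = K ^ 2 * (α' * γ') / (α' * γ') ^ 2 by field_simp]
    exact div_neg_of_neg_of_pos (mul_neg_of_pos_of_neg (by positivity) hminor)
      (by have := hminor.ne; positivity)
  simp only [hform]
  rcases mul_neg_iff.mp hprod with ⟨h1, h2⟩ | ⟨h1, h2⟩
  · exact isHyperbola_of_axes hu hα hγ hK h1 h2
  · simp only [conicForm_quarter_turn α' γ' δ' ε' φ u]
    exact isHyperbola_of_axes (by simp [hu]) hγ hα (by rw [hK]; ring) h2 h1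

lemma isParabola_of_axes_of_pos {u : ℂ} (hu : ‖u‖ = 1) {α δ ε φ : ℝ} (hα : α ≠ 0)
    (hk : 0 < -(α / (2 * ε))) :
    IsParabola {z | conicForm α 0 0 δ ε φ (z * conj u) = 0} := by
  have huc : u * conj u = 1 := by rw [Complex.mul_conj, Complex.normSq_eq_norm_sq, hu]; simp
  have hε : ε ≠ 0 := by rintro rfl; simp at hk
  set m : ℝ := (φ - δ ^ 2 / α) / (2 * ε) with hm
  refine ⟨u * ⟨-(δ / α), -m⟩, u, -(α / (2 * ε)), hu, hk, ?_⟩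
  ext z
  have hfc : frameCoord (u * ⟨-(δ / α), -m⟩) u z = z * conj u + ⟨δ / α, m⟩ := by
    have : (⟨-(δ / α), -m⟩ : ℂ) = -⟨δ / α, m⟩ := by
      apply Complex.ext <;> simp
    rw [frameCoord, this]; linear_combination (⟨δ / α, m⟩ : ℂ) * huc
  simp only [Set.mem_ofPred_eq, hfc, Complex.add_re, Complex.add_im]
  have key : conicForm α 0 0 δ ε φ (z * conj u) =
      2 * ε * (((z * conj u).im + m) - -(α / (2 * ε)) * ((z * conj u).re + δ / α) ^ 2) := by
    rw [hm, conicForm]; field_simp; ring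
  rw [key, mul_eq_zero, or_iff_right (by simpa using hε), sub_eq_zero]

lemma isParabola_of_axes {u : ℂ} (hu : ‖u‖ = 1) {α δ ε φ : ℝ} (hα : α ≠ 0) (hε : ε ≠ 0) :
    IsParabola {z | conicForm α 0 0 δ ε φ (z * conj u) = 0} := by
  have h0 : -(α / (2 * ε)) ≠ 0 := by simp [hα, hε]
  rcases h0.lt_or_gt with h | h
  · have : ∀ z, conicForm α 0 0 δ ε φ (z * conj u) =
        conicForm α 0 0 (-δ) (-ε) φ (z * conj (-u)) := by
      intro z
      rw [map_neg, mul_neg]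
      simp [conicForm]; ring
    simp only [this]
    exact isParabola_of_axes_of_pos (by simpa using hu) hα
      (by rw [mul_neg, div_neg]; linarith)
  · exact isParabola_of_axes_of_pos hu hα h

/-- A nondegenerate conic with vanishing minor is a parabola. -/
lemma isParabola_conicForm {α β γ δ ε φ : ℝ} (hminor : α * γ - β ^ 2 = 0)
    (hdet : conicDet α β γ δ ε φ ≠ 0) :
    IsParabola {z | conicForm α β γ δ ε φ z = 0} := by
  obtain ⟨u, α', γ', δ', ε', hu, hform, hmin, hd⟩ := exists_principal_axes α β γ δ ε φ
  rw [← hd] at hdet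
  rw [← hmin] at hminor
  simp only [hform]
  rcases mul_eq_zero.mp hminor with rfl | rfl
  · simp only [conicForm_quarter_turn 0 γ' δ' ε' φ u]
    refine isParabola_of_axes (by simp [hu]) ?_ ?_ <;> rintro h <;> apply hdet
    · simp [conicDet, h]
    · simp [conicDet, neg_eq_zero.mp h]
  · refine isParabola_of_axes hu ?_ ?_ <;> rintro rfl <;> apply hdet <;> simp [conicDet]

lemma frameCoord_div_sub (c u z O : ℂ) {k : ℝ} (hk : k ≠ 0) :
    frameCoord c u ((z - O) / k) = frameCoord (O + k * c) u z / k := by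
  have : (k : ℂ) ≠ 0 := by exact_mod_cast hk
  simp only [frameCoord]; field_simp; ring

lemma IsEllipse.homothety {S : Set ℂ} (hS : IsEllipse S) (O : ℂ) {k : ℝ} (hk : 0 < k) :
    IsEllipse {z | (z - O) / k ∈ S} := by
  obtain ⟨⟨c, u, a, b, hu, ha, hb⟩, rfl⟩ := hS
  refine ⟨⟨O + k * c, u, k * a, k * b, hu, by positivity, by positivity⟩, ?_⟩
  ext z
  simp only [PlaneEllipse.curve, PlaneEllipse.form, Set.mem_ofPred_eq,
    frameCoord_div_sub _ _ _ _ hk.ne', Complex.div_ofReal_re, Complex.div_ofReal_im, div_div]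

lemma IsHyperbola.homothety {S : Set ℂ} (hS : IsHyperbola S) (O : ℂ) {k : ℝ} (hk : 0 < k) :
    IsHyperbola {z | (z - O) / k ∈ S} := by
  obtain ⟨c, u, a, b, hu, ha, hb, rfl⟩ := hS
  refine ⟨O + k * c, u, k * a, k * b, hu, by positivity, by positivity, ?_⟩
  ext z
  simp only [Set.mem_ofPred_eq,
    frameCoord_div_sub _ _ _ _ hk.ne', Complex.div_ofReal_re, Complex.div_ofReal_im, div_div]

lemma IsParabola.homothety {S : Set ℂ} (hS : IsParabola S) (O : ℂ) {k : ℝ} (hk : 0 < k) :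
    IsParabola {z | (z - O) / k ∈ S} := by
  obtain ⟨c, u, a, hu, ha, rfl⟩ := hS
  refine ⟨O + k * c, u, a / k, hu, by positivity, ?_⟩
  ext z
  simp only [Set.mem_ofPred_eq,
    frameCoord_div_sub _ _ _ _ hk.ne', Complex.div_ofReal_re, Complex.div_ofReal_im]
  rw [div_pow]
  constructor <;> intro h <;> field_simp at h ⊢ <;> linarith

/-! ### Circles with a common power and centres on an ellipse -/

/-- The point `c₀ + A l + B conj l`. As `l` runs over the unit circle it traces an ellipse when
`|A| ≠ |B|`. -/
def ellipsePoint (c₀ A B l : ℂ) : ℂ := c₀ + A * l + B * conj l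

/-- The power of the point `P` with respect to the circle with centre `ellipsePoint c₀ A B l`
for which the origin has power `q`. -/
def netPower (q : ℝ) (c₀ A B P l : ℂ) : ℝ :=
  Complex.normSq P - 2 * (conj P * ellipsePoint c₀ A B l).re + q

/-- `netPower q c₀ A B P` is the real affine function `k₀ + k · l` of `l`; this is
`k₀² - |k|²`. Unless the affine function vanishes identically, this is positive, zero or negative
according to whether it has no, one or two zeros on the unit circle. -/
def netDisc (q : ℝ) (c₀ A B P : ℂ) : ℝ :=
  (Complex.normSq P - 2 * (conj P * c₀).re + q) ^ 2 -
    4 * Complex.normSq (conj P * A + P * conj B)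

lemma netPower_eq (q : ℝ) (c₀ A B P l : ℂ) :
    netPower q c₀ A B P l = Complex.normSq P - 2 * (conj P * c₀).re + q +
      -2 * (conj P * A + P * conj B).re * l.re + 2 * (conj P * A + P * conj B).im * l.im := by
  simp [netPower, ellipsePoint, Complex.normSq_apply]; ring

lemma exists_norm_one_affine_eq_zero_iff (k₀ k₁ k₂ : ℝ) :
    (∃ l : ℂ, ‖l‖ = 1 ∧ k₀ + k₁ * l.re + k₂ * l.im = 0) ↔ k₀ ^ 2 ≤ k₁ ^ 2 + k₂ ^ 2 := by
  constructor
  · rintro ⟨l, hl, h⟩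
    rw [norm_eq_one_iff_re_im] at hl
    have h1 : k₀ ^ 2 = (k₁ * l.re + k₂ * l.im) ^ 2 := by
      rw [show k₁ * l.re + k₂ * l.im = -k₀ by linarith]; ring
    have h2 : k₁ ^ 2 + k₂ ^ 2 - k₀ ^ 2 = (k₁ * l.im - k₂ * l.re) ^ 2 := by
      rw [h1]; linear_combination (-(k₁ ^ 2 + k₂ ^ 2)) * hl
    nlinarith [sq_nonneg (k₁ * l.im - k₂ * l.re)]
  · intro h
    rcases (by positivity : 0 ≤ k₁ ^ 2 + k₂ ^ 2).eq_or_lt with hK | hK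
    · have h1 : k₁ = 0 := by nlinarith [sq_nonneg k₁, sq_nonneg k₂]
      have h2 : k₂ = 0 := by nlinarith [sq_nonneg k₁, sq_nonneg k₂]
      have h0 : k₀ = 0 := by nlinarith [sq_nonneg k₀]
      exact ⟨1, by simp, by simp [h0, h1, h2]⟩
    · set K := k₁ ^ 2 + k₂ ^ 2 with hKdef
      have hs : √(K - k₀ ^ 2) ^ 2 = K - k₀ ^ 2 := Real.sq_sqrt (by linarith)
      set s := √(K - k₀ ^ 2)
      refine ⟨⟨(-k₀ * k₁ - k₂ * s) / K, (-k₀ * k₂ + k₁ * s) / K⟩, ?_, ?_⟩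
      · rw [norm_eq_one_iff_re_im]
        simp only
        field_simp
        linear_combination (k₁ ^ 2 + k₂ ^ 2) * hs + (-k₀ ^ 2 - (K - k₀ ^ 2) - K + K) * hKdef
      · simp only
        field_simp
        linear_combination k₀ * hKdef

lemma exists_netPower_eq_zero_iff (q : ℝ) (c₀ A B P : ℂ) :
    (∃ l : ℂ, ‖l‖ = 1 ∧ netPower q c₀ A B P l = 0) ↔ netDisc q c₀ A B P ≤ 0 := by
  simp only [netPower_eq, exists_norm_one_affine_eq_zero_iff, netDisc, Complex.normSq_apply]
  constructor <;> intro h <;> nlinarith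

/-- Elimination of the parameter `(x, y)` from `Y = (c - P) / p`, where `c = c₀ + L (x, y)` and
`p = |P|² - 2 ⟨P, c⟩ + q`. The reason it is possible rationally: `p (1 + 2 ⟨P, Y⟩)` is the constant
`q - |P|²`. -/
lemma exists_param_iff {l₁ l₂ l₃ l₄ c₁ c₂ p₁ p₂ q h D e₁ e₂ : ℝ} (hD : D = l₁ * l₄ - l₂ * l₃)
    (hD0 : D ≠ 0) (hh : h = p₁ ^ 2 + p₂ ^ 2 - q) (hh0 : h ≠ 0)
    (he₁ : e₁ = l₄ * (p₁ - c₁) - l₂ * (p₂ - c₂)) (he₂ : e₂ = -l₃ * (p₁ - c₁) + l₁ * (p₂ - c₂))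
    (y₁ y₂ : ℝ) :
    (∃ x y p : ℝ, x ^ 2 + y ^ 2 = 1 ∧ p ≠ 0 ∧
      p = p₁ ^ 2 + p₂ ^ 2 - 2 * (p₁ * (c₁ + l₁ * x + l₂ * y) + p₂ * (c₂ + l₃ * x + l₄ * y)) + q ∧
      y₁ * p = c₁ + l₁ * x + l₂ * y - p₁ ∧ y₂ * p = c₂ + l₃ * x + l₄ * y - p₂) ↔
    ((2 * e₁ * p₁ - h * l₄) * y₁ + (2 * e₁ * p₂ + h * l₂) * y₂ + e₁) ^ 2 +
      ((2 * e₂ * p₁ + h * l₃) * y₁ + (2 * e₂ * p₂ - h * l₁) * y₂ + e₂) ^ 2 -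
      (2 * D * p₁ * y₁ + 2 * D * p₂ * y₂ + D) ^ 2 = 0 := by
  set w := 1 + 2 * (p₁ * y₁ + p₂ * y₂) with hw
  set v₁ := (p₁ - c₁) * w - h * y₁ with hv₁
  set v₂ := (p₂ - c₂) * w - h * y₂ with hv₂
  have hn₁ : (2 * e₁ * p₁ - h * l₄) * y₁ + (2 * e₁ * p₂ + h * l₂) * y₂ + e₁ =
      l₄ * v₁ - l₂ * v₂ := by rw [hv₁, hv₂, hw, he₁]; ring
  have hn₂ : (2 * e₂ * p₁ + h * l₃) * y₁ + (2 * e₂ * p₂ - h * l₁) * y₂ + e₂ =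
      -l₃ * v₁ + l₁ * v₂ := by rw [hv₁, hv₂, hw, he₂]; ring
  have hn₃ : 2 * D * p₁ * y₁ + 2 * D * p₂ * y₂ + D = D * w := by rw [hw]; ring
  rw [hn₁, hn₂, hn₃]
  constructor
  · rintro ⟨x, y, p, hxy, hp0, hp, h₁, h₂⟩
    have hwp : w * p = -h := by
      rw [hw]; linear_combination 2 * p₁ * h₁ + 2 * p₂ * h₂ + hh + hp
    have hV₁ : p * v₁ = -h * (l₁ * x + l₂ * y) := by
      rw [hv₁]; linear_combination (p₁ - c₁) * hwp - h * h₁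
    have hV₂ : p * v₂ = -h * (l₃ * x + l₄ * y) := by
      rw [hv₂]; linear_combination (p₂ - c₂) * hwp - h * h₂
    have hN₁ : p * (l₄ * v₁ - l₂ * v₂) = -h * D * x := by
      rw [hD]; linear_combination l₄ * hV₁ - l₂ * hV₂
    have hN₂ : p * (-l₃ * v₁ + l₁ * v₂) = -h * D * y := by
      rw [hD]; linear_combination -l₃ * hV₁ + l₁ * hV₂
    have : p ^ 2 * ((l₄ * v₁ - l₂ * v₂) ^ 2 + (-l₃ * v₁ + l₁ * v₂) ^ 2 - (D * w) ^ 2) = 0 := by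
      have e : p ^ 2 * ((l₄ * v₁ - l₂ * v₂) ^ 2 + (-l₃ * v₁ + l₁ * v₂) ^ 2 - (D * w) ^ 2) =
        (p * (l₄ * v₁ - l₂ * v₂)) ^ 2 + (p * (-l₃ * v₁ + l₁ * v₂)) ^ 2 - (D * (w * p)) ^ 2 := by
        ring
      rw [e, hN₁, hN₂, hwp]
      linear_combination h ^ 2 * D ^ 2 * hxy
    exact (mul_eq_zero.mp this).resolve_left (pow_ne_zero 2 hp0)
  · intro hc
    have hw0 : w ≠ 0 := by
      intro h0
      rw [h0, mul_zero] at hc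
      obtain ⟨hz₁, hz₂⟩ := (add_eq_zero_iff_of_nonneg (sq_nonneg (l₄ * v₁ - l₂ * v₂))
        (sq_nonneg (-l₃ * v₁ + l₁ * v₂))).mp (by linarith only [hc])
      rw [sq_eq_zero_iff] at hz₁ hz₂
      have hDv₁ : D * h * y₁ = 0 := by
        rw [hD]; rw [h0] at hv₁ hv₂
        linear_combination -l₁ * hz₁ - l₂ * hz₂ + (l₁ * l₄ - l₂ * l₃) * hv₁
      have hDv₂ : D * h * y₂ = 0 := by
        rw [hD]; rw [h0] at hv₁ hv₂
        linear_combination -l₃ * hz₁ - l₄ * hz₂ + (l₁ * l₄ - l₂ * l₃) * hv₂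
      have hy₁ : y₁ = 0 := by simpa [hD0, hh0] using hDv₁
      have hy₂ : y₂ = 0 := by simpa [hD0, hh0] using hDv₂
      rw [hw, hy₁, hy₂] at h0
      norm_num at h0
    have hL₁ : l₁ * ((l₄ * v₁ - l₂ * v₂) / (D * w)) + l₂ * ((-l₃ * v₁ + l₁ * v₂) / (D * w)) =
        p₁ - c₁ - h * y₁ / w := by
      field_simp
      rw [hD]; linear_combination (l₁ * l₄ - l₂ * l₃) * hv₁
    have hL₂ : l₃ * ((l₄ * v₁ - l₂ * v₂) / (D * w)) + l₄ * ((-l₃ * v₁ + l₁ * v₂) / (D * w)) =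
        p₂ - c₂ - h * y₂ / w := by
      field_simp
      rw [hD]; linear_combination (l₁ * l₄ - l₂ * l₃) * hv₂
    refine ⟨(l₄ * v₁ - l₂ * v₂) / (D * w), (-l₃ * v₁ + l₁ * v₂) / (D * w), -h / w, ?_, ?_, ?_,
      ?_, ?_⟩
    · field_simp
      linarith
    · exact div_ne_zero (neg_ne_zero.mpr hh0) hw0
    · rw [add_assoc, hL₁, add_assoc, hL₂]
      field_simp
      rw [hw, hh]; ring
    · rw [add_assoc, hL₁]; ring
    · rw [add_assoc, hL₂]; ring

/-- The set of points `(c - P) / p`, for `c` a centre in the net and `p ≠ 0` the power of `P`,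
is a nondegenerate conic, and the sign of its minor is that of `netDisc`. -/
lemma exists_conicForm_eq_locus {q : ℝ} (hq : q < 0) (c₀ : ℂ) {A B : ℂ}
    (hAB : Complex.normSq A ≠ Complex.normSq B) (P : ℂ) :
    ∃ α β γ δ ε φ κ : ℝ, 0 < κ ∧
      {Y : ℂ | ∃ l, ‖l‖ = 1 ∧ netPower q c₀ A B P l ≠ 0 ∧
        Y = (ellipsePoint c₀ A B l - P) / netPower q c₀ A B P l} =
        {Y | conicForm α β γ δ ε φ Y = 0} ∧
      α * γ - β ^ 2 = κ * netDisc q c₀ A B P ∧ conicDet α β γ δ ε φ ≠ 0 := by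
  obtain ⟨l₁, hl₁⟩ : ∃ x, x = A.re + B.re := ⟨_, rfl⟩
  obtain ⟨l₂, hl₂⟩ : ∃ x, x = B.im - A.im := ⟨_, rfl⟩
  obtain ⟨l₃, hl₃⟩ : ∃ x, x = A.im + B.im := ⟨_, rfl⟩
  obtain ⟨l₄, hl₄⟩ : ∃ x, x = A.re - B.re := ⟨_, rfl⟩
  obtain ⟨D, hD⟩ : ∃ x, x = l₁ * l₄ - l₂ * l₃ := ⟨_, rfl⟩
  obtain ⟨h, hh⟩ : ∃ x, x = P.re ^ 2 + P.im ^ 2 - q := ⟨_, rfl⟩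
  obtain ⟨e₁, he₁⟩ : ∃ x, x = l₄ * (P.re - c₀.re) - l₂ * (P.im - c₀.im) := ⟨_, rfl⟩
  obtain ⟨e₂, he₂⟩ : ∃ x, x = -l₃ * (P.re - c₀.re) + l₁ * (P.im - c₀.im) := ⟨_, rfl⟩
  have hD0 : D ≠ 0 := by
    intro h0
    apply hAB
    rw [Complex.normSq_apply, Complex.normSq_apply]
    rw [hD, hl₁, hl₂, hl₃, hl₄] at h0
    linarith
  have hh0 : 0 < h := by rw [hh]; nlinarith [sq_nonneg P.re, sq_nonneg P.im]
  obtain ⟨A₁, hA₁⟩ : ∃ x, x = 2 * e₁ * P.re - h * l₄ := ⟨_, rfl⟩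
  obtain ⟨B₁, hB₁⟩ : ∃ x, x = 2 * e₁ * P.im + h * l₂ := ⟨_, rfl⟩
  obtain ⟨A₂, hA₂⟩ : ∃ x, x = 2 * e₂ * P.re + h * l₃ := ⟨_, rfl⟩
  obtain ⟨B₂, hB₂⟩ : ∃ x, x = 2 * e₂ * P.im - h * l₁ := ⟨_, rfl⟩
  obtain ⟨k₀, hk₀⟩ : ∃ x, x = P.re ^ 2 + P.im ^ 2 - 2 * (P.re * c₀.re + P.im * c₀.im) + q :=
    ⟨_, rfl⟩
  have hx₁ : e₁ * l₁ + e₂ * l₂ = D * (P.re - c₀.re) := by rw [he₁, he₂, hD]; ring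
  have hx₂ : e₁ * l₃ + e₂ * l₄ = D * (P.im - c₀.im) := by rw [he₁, he₂, hD]; ring
  -- The `2 × 2` minors of the three affine forms whose squares make up the equation.
  have hm₁₂ : A₁ * B₂ - A₂ * B₁ = -(h * D) * k₀ := by
    rw [hA₁, hB₁, hA₂, hB₂, hk₀]
    linear_combination (-2 * h * P.re) * hx₁ - 2 * h * P.im * hx₂ - h ^ 2 * hD + h * D * hh
  have hm₁₃ : A₁ * (2 * D * P.im) - 2 * D * P.re * B₁ =
      -(h * D) * (2 * (l₂ * P.re + l₄ * P.im)) := by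
    rw [hA₁, hB₁]; ring
  have hm₂₃ : A₂ * (2 * D * P.im) - 2 * D * P.re * B₂ =
      (h * D) * (2 * (l₁ * P.re + l₃ * P.im)) := by
    rw [hA₂, hB₂]; ring
  refine ⟨A₁ ^ 2 + A₂ ^ 2 - (2 * D * P.re) ^ 2, A₁ * B₁ + A₂ * B₂ - 2 * D * P.re * (2 * D * P.im),
    B₁ ^ 2 + B₂ ^ 2 - (2 * D * P.im) ^ 2, A₁ * e₁ + A₂ * e₂ - 2 * D * P.re * D,
    B₁ * e₁ + B₂ * e₂ - 2 * D * P.im * D, e₁ ^ 2 + e₂ ^ 2 - D ^ 2, (h * D) ^ 2, by positivity,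
    ?_, ?_, ?_⟩
  · ext Y
    have key := exists_param_iff (c₁ := c₀.re) (c₂ := c₀.im) hD hD0 hh hh0.ne' he₁ he₂ Y.re Y.im
    rw [← hA₁, ← hB₁, ← hA₂, ← hB₂] at key
    simp only [Set.mem_ofPred_eq]
    have hform : conicForm (A₁ ^ 2 + A₂ ^ 2 - (2 * D * P.re) ^ 2)
        (A₁ * B₁ + A₂ * B₂ - 2 * D * P.re * (2 * D * P.im))
        (B₁ ^ 2 + B₂ ^ 2 - (2 * D * P.im) ^ 2) (A₁ * e₁ + A₂ * e₂ - 2 * D * P.re * D)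
        (B₁ * e₁ + B₂ * e₂ - 2 * D * P.im * D) (e₁ ^ 2 + e₂ ^ 2 - D ^ 2) Y =
        (A₁ * Y.re + B₁ * Y.im + e₁) ^ 2 + (A₂ * Y.re + B₂ * Y.im + e₂) ^ 2 -
          (2 * D * P.re * Y.re + 2 * D * P.im * Y.im + D) ^ 2 := by
      rw [conicForm]; ring
    rw [hform, ← key]
    have hpow : ∀ l : ℂ, netPower q c₀ A B P l = P.re ^ 2 + P.im ^ 2 -
        2 * (P.re * (c₀.re + l₁ * l.re + l₂ * l.im) +
          P.im * (c₀.im + l₃ * l.re + l₄ * l.im)) + q := by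
      intro l
      rw [hl₁, hl₂, hl₃, hl₄]
      simp [netPower, ellipsePoint, Complex.normSq_apply]; ring
    have hre : ∀ l : ℂ, (ellipsePoint c₀ A B l).re = c₀.re + l₁ * l.re + l₂ * l.im := by
      intro l; rw [hl₁, hl₂]; simp [ellipsePoint]; ring
    have him : ∀ l : ℂ, (ellipsePoint c₀ A B l).im = c₀.im + l₃ * l.re + l₄ * l.im := by
      intro l; rw [hl₃, hl₄]; simp [ellipsePoint]; ring
    have hdiv : ∀ (p : ℝ) (W : ℂ), p ≠ 0 → (Y = W / p ↔ Y.re * p = W.re ∧ Y.im * p = W.im) := by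
      intro p W hp
      have : (p : ℂ) ≠ 0 := by exact_mod_cast hp
      rw [eq_div_iff this, Complex.ext_iff]
      simp
    constructor
    · rintro ⟨l, hl, hp, hY⟩
      rw [hdiv _ _ hp, Complex.sub_re, Complex.sub_im, hre, him] at hY
      exact ⟨l.re, l.im, _, (norm_eq_one_iff_re_im l).mp hl, hp, hpow l, hY.1, hY.2⟩
    · rintro ⟨x, y, p, hxy, hp0, hp, h₁, h₂⟩
      have hpl : netPower q c₀ A B P ⟨x, y⟩ = p := by rw [hpow, hp]
      refine ⟨⟨x, y⟩, (norm_eq_one_iff_re_im _).mpr hxy, by rwa [hpl], ?_⟩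
      rw [hpl, hdiv _ _ hp0, Complex.sub_re, Complex.sub_im, hre, him]
      exact ⟨h₁, h₂⟩
  · have hdisc : netDisc q c₀ A B P = k₀ ^ 2 - (2 * (l₁ * P.re + l₃ * P.im)) ^ 2 -
        (2 * (l₂ * P.re + l₄ * P.im)) ^ 2 := by
      rw [hk₀, hl₁, hl₂, hl₃, hl₄]
      simp [netDisc, Complex.normSq_apply]; ring
    rw [hdisc]
    linear_combination (A₁ * B₂ - A₂ * B₁ - (h * D) * k₀) * hm₁₂ -
      (A₁ * (2 * D * P.im) - 2 * D * P.re * B₁ - (h * D) * (2 * (l₂ * P.re + l₄ * P.im))) * hm₁₃ -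
      (A₂ * (2 * D * P.im) - 2 * D * P.re * B₂ + (h * D) * (2 * (l₁ * P.re + l₃ * P.im))) * hm₂₃
  · have hdet : D * (A₁ * B₂ - A₂ * B₁) - e₂ * (A₁ * (2 * D * P.im) - 2 * D * P.re * B₁) +
        e₁ * (A₂ * (2 * D * P.im) - 2 * D * P.re * B₂) = (h * D) ^ 2 := by
      rw [hm₁₂, hm₁₃, hm₂₃, hk₀]
      linear_combination 2 * h * D * P.re * hx₁ + 2 * h * D * P.im * hx₂ - h * D ^ 2 * hh
    have : conicDet (A₁ ^ 2 + A₂ ^ 2 - (2 * D * P.re) ^ 2)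
        (A₁ * B₁ + A₂ * B₂ - 2 * D * P.re * (2 * D * P.im))
        (B₁ ^ 2 + B₂ ^ 2 - (2 * D * P.im) ^ 2) (A₁ * e₁ + A₂ * e₂ - 2 * D * P.re * D)
        (B₁ * e₁ + B₂ * e₂ - 2 * D * P.im * D) (e₁ ^ 2 + e₂ ^ 2 - D ^ 2) =
        -((h * D) ^ 2) ^ 2 := by
      rw [← hdet, conicDet]; ring
    rw [this]
    have := hh0.ne'
    simp [this, hD0]

/-- The affine function `netPower q c₀ A B P` does not vanish identically on the circle. -/
lemma exists_netPower_ne_zero {q : ℝ} (hq : q < 0) (c₀ : ℂ) {A B : ℂ}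
    (hAB : Complex.normSq A ≠ Complex.normSq B) (P : ℂ) :
    ∃ l, ‖l‖ = 1 ∧ netPower q c₀ A B P l ≠ 0 := by
  by_contra! hall
  have h1 := hall 1 (by simp)
  have h2 := hall (-1) (by simp)
  have h3 := hall Complex.I (by simp)
  have h4 := hall (-Complex.I) (by simp)
  rw [netPower_eq] at h1 h2 h3 h4
  simp only [Complex.one_re, Complex.one_im, Complex.neg_re, Complex.neg_im, Complex.I_re,
    Complex.I_im] at h1 h2 h3 h4
  have hK : conj P * A + P * conj B = 0 := by
    apply Complex.ext
    · rw [Complex.zero_re]; linarith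
    · rw [Complex.zero_im]; linarith
  have hk0 : Complex.normSq P - 2 * (conj P * c₀).re + q = 0 := by linarith
  have hP : P = 0 := by
    have h5 : Complex.normSq (conj P * A) = Complex.normSq (P * conj B) := by
      rw [eq_neg_of_add_eq_zero_left hK, Complex.normSq_neg]
    rw [Complex.normSq_mul, Complex.normSq_mul, Complex.normSq_conj, Complex.normSq_conj] at h5
    by_contra hP
    exact hAB (mul_left_cancel₀ (Complex.normSq_pos.mpr hP).ne' h5)
  rw [hP] at hk0
  simp at hk0
  exact hq.ne hk0

/-- The union of the circles of the net, in coordinates centred at the point of constant power. -/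
def netRegion (q : ℝ) (c₀ A B : ℂ) : Set ℂ := {P | netDisc q c₀ A B P ≤ 0}

lemma continuous_netDisc (q : ℝ) (c₀ A B : ℂ) : Continuous (netDisc q c₀ A B) := by
  unfold netDisc
  have : Continuous Complex.normSq := Complex.continuous_normSq
  fun_prop

/-- A point where the discriminant vanishes is a boundary point of the region: moving it along
the ray from the point of constant power, in one of the two directions, makes the discriminant
positive. -/
lemma notMem_interior_netRegion {q : ℝ} (hq : q < 0) {c₀ A B P : ℂ}
    (hP : netDisc q c₀ A B P = 0) : P ∉ interior (netRegion q c₀ A B) := by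
  intro hint
  set κ := 2 * ‖conj P * A + P * conj B‖ with hκ
  set H := Complex.normSq P with hH
  set b := 2 * (conj P * c₀).re with hb
  have hκ0 : 0 ≤ κ := by positivity
  have hH0 : 0 ≤ H := Complex.normSq_nonneg P
  have hray : ∀ t : ℝ, netDisc q c₀ A B (t * P) =
      (t ^ 2 * H - t * b + q) ^ 2 - (t * κ) ^ 2 := by
    intro t
    have h1 : conj ((t : ℂ) * P) * A + t * P * conj B = t * (conj P * A + P * conj B) := by
      simp; ring
    have h2 : (conj ((t : ℂ) * P) * c₀).re = t * (conj P * c₀).re := by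
      simp; ring
    rw [netDisc, h1, h2, Complex.normSq_mul, Complex.normSq_mul, Complex.normSq_ofReal, hκ, hb,
      Complex.normSq_eq_norm_sq (conj P * A + P * conj B)]
    ring
  have hcont : Continuous fun t : ℝ => (t : ℂ) * P := by fun_prop
  have hev : ∀ᶠ t : ℝ in nhds 1, netDisc q c₀ A B (t * P) ≤ 0 := by
    have : netRegion q c₀ A B ∈ nhds (((1 : ℝ) : ℂ) * P) := by
      simpa using mem_interior_iff_mem_nhds.mp hint
    exact hcont.continuousAt.eventually this
  obtain ⟨η, hη, hball⟩ := Metric.eventually_nhds_iff.mp hev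
  have hP1 := hray 1
  rw [Complex.ofReal_one, one_mul, hP] at hP1
  have hfac : (H - b + q - κ) * (H - b + q + κ) = 0 := by linarith
  rcases mul_eq_zero.mp hfac with h | h
  · set t := 1 + min η 1 / 2 with ht
    have hm : 0 < min η 1 := lt_min hη one_pos
    have htη : dist t 1 < η := by
      rw [Real.dist_eq, ht, add_sub_cancel_left, abs_of_pos (by linarith)]
      linarith [min_le_left η 1]
    have h1 := hball htη
    rw [hray] at h1
    have ht1 : 1 < t := by linarith
    -- The quadratic `t² H - t b + q - t κ` has the root `1` and is `(t - 1) (t H - q)`.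
    have hpos : 0 < t ^ 2 * H - t * b + q - t * κ := by
      have : t ^ 2 * H - t * b + q - t * κ = (t - 1) * (t * H - q) := by
        linear_combination t * h
      rw [this]
      have : 0 ≤ t * H := by positivity
      exact mul_pos (by linarith) (by linarith)
    have : 0 ≤ t * κ := by positivity
    nlinarith
  · set t := 1 - min η 1 / 2 with ht
    have hm : 0 < min η 1 := lt_min hη one_pos
    have hm1 : min η 1 ≤ 1 := min_le_right η 1
    have htη : dist t 1 < η := by
      rw [Real.dist_eq, ht, abs_sub_comm, sub_sub_cancel, abs_of_pos (by linarith)]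
      linarith [min_le_left η 1]
    have h1 := hball htη
    rw [hray] at h1
    have ht1 : t < 1 := by linarith
    have ht0 : 0 < t := by linarith
    have hneg : t ^ 2 * H - t * b + q + t * κ < 0 := by
      have : t ^ 2 * H - t * b + q + t * κ = (t - 1) * (t * H - q) := by
        linear_combination t * h
      rw [this]
      have : 0 ≤ t * H := by positivity
      exact mul_neg_of_neg_of_pos (by linarith) (by linarith)
    have : 0 ≤ t * κ := by positivity
    nlinarith

lemma netDisc_neg_of_mem_interior {q : ℝ} (hq : q < 0) {c₀ A B P : ℂ}
    (hP : P ∈ interior (netRegion q c₀ A B)) : netDisc q c₀ A B P < 0 := by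
  have hle : P ∈ netRegion q c₀ A B := interior_subset hP
  exact lt_of_le_of_ne hle fun h => notMem_interior_netRegion hq h hP

lemma netDisc_eq_zero_of_mem_frontier {q : ℝ} {c₀ A B P : ℂ}
    (hP : P ∈ frontier (netRegion q c₀ A B)) : netDisc q c₀ A B P = 0 :=
  frontier_le_subset_eq (continuous_netDisc q c₀ A B) continuous_const hP

/-- The three cases for the locus of the inverted centres `O + k (c - P) / p`. -/
lemma locus_trichotomy {q : ℝ} (hq : q < 0) (c₀ : ℂ) {A B : ℂ}
    (hAB : Complex.normSq A ≠ Complex.normSq B) (P O : ℂ) {k : ℝ} (hk : 0 < k) {S : Set ℂ}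
    (hS : S = {X | ∃ l, ‖l‖ = 1 ∧ netPower q c₀ A B P l ≠ 0 ∧
      X = O + k * ((ellipsePoint c₀ A B l - P) / netPower q c₀ A B P l)}) :
    (0 < netDisc q c₀ A B P → IsEllipse S) ∧ (netDisc q c₀ A B P < 0 → IsHyperbola S) ∧
      (netDisc q c₀ A B P = 0 → IsParabola S) := by
  obtain ⟨α, β, γ, δ, ε, φ, κ, hκ, hset, hmin, hdet⟩ := exists_conicForm_eq_locus hq c₀ hAB P
  have hk' : (k : ℂ) ≠ 0 := by exact_mod_cast hk.ne'
  have hS' : S = {X | (X - O) / k ∈ {Y | conicForm α β γ δ ε φ Y = 0}} := by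
    rw [hS, ← hset]
    ext X
    simp only [Set.mem_ofPred_eq, div_eq_iff hk', sub_eq_iff_eq_add', mul_comm (k : ℂ)]
  rw [hS']
  refine ⟨fun h => ?_, fun h => ?_, fun h => ?_⟩
  · refine (isEllipse_conicForm (by rw [hmin]; positivity) hdet ?_).homothety O hk
    obtain ⟨l, hl, hl0⟩ := exists_netPower_ne_zero hq c₀ hAB P
    exact ⟨_, hset.le ⟨l, hl, hl0, rfl⟩⟩
  · exact (isHyperbola_conicForm (by rw [hmin]; exact mul_neg_of_pos_of_neg hκ h)
      hdet).homothety O hk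
  · exact (isParabola_conicForm (by rw [hmin, h, mul_zero]) hdet).homothety O hk

/-! ### Ellipses as affine images of the unit circle -/

namespace PlaneEllipse

/-- The real affine map carrying the unit circle to the ellipse, with `1` and `i` going to the
ends of the axes. -/
def param (E : PlaneEllipse) (z : ℂ) : ℂ :=
  E.center + E.dir * (((E.a + E.b) / 2 : ℝ) * z + ((E.a - E.b) / 2 : ℝ) * conj z)

lemma dir_mul_conj (E : PlaneEllipse) : E.dir * conj E.dir = 1 := by
  rw [Complex.mul_conj, Complex.normSq_eq_norm_sq, E.norm_dir]; simp

lemma frameCoord_param (E : PlaneEllipse) (z : ℂ) :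
    frameCoord E.center E.dir (E.param z) = ⟨E.a * z.re, E.b * z.im⟩ := by
  have h : frameCoord E.center E.dir (E.param z) =
      ((E.a + E.b) / 2 : ℝ) * z + ((E.a - E.b) / 2 : ℝ) * conj z := by
    rw [frameCoord, param]; linear_combination
      (((E.a + E.b) / 2 : ℝ) * z + ((E.a - E.b) / 2 : ℝ) * conj z) * E.dir_mul_conj
  rw [h]
  apply Complex.ext
  · simp only [Complex.add_re, Complex.re_ofReal_mul, Complex.conj_re]; ring
  · simp only [Complex.add_im, Complex.im_ofReal_mul, Complex.conj_im]; ring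

lemma form_param (E : PlaneEllipse) (z : ℂ) : E.form (E.param z) = ‖z‖ ^ 2 := by
  have := E.a_pos.ne'
  have := E.b_pos.ne'
  rw [form, frameCoord_param, Complex.sq_norm, Complex.normSq_apply]
  field_simp

lemma param_injective (E : PlaneEllipse) : Function.Injective E.param := by
  intro z w h
  have h' := congrArg (frameCoord E.center E.dir) h
  rw [frameCoord_param, frameCoord_param, Complex.ext_iff] at h'
  exact Complex.ext (mul_left_cancel₀ E.a_pos.ne' h'.1) (mul_left_cancel₀ E.b_pos.ne' h'.2)

lemma param_surjective (E : PlaneEllipse) : Function.Surjective E.param := by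
  intro z
  refine ⟨⟨(frameCoord E.center E.dir z).re / E.a, (frameCoord E.center E.dir z).im / E.b⟩, ?_⟩
  have h := E.frameCoord_param
    ⟨(frameCoord E.center E.dir z).re / E.a, (frameCoord E.center E.dir z).im / E.b⟩
  rw [mul_div_cancel₀ _ E.a_pos.ne', mul_div_cancel₀ _ E.b_pos.ne', Complex.eta] at h
  have hd : conj E.dir ≠ 0 := right_ne_zero_of_mul_eq_one E.dir_mul_conj
  exact sub_left_injective (mul_right_cancel₀ hd h)

lemma param_mem_curve_iff (E : PlaneEllipse) (z : ℂ) : E.param z ∈ E.curve ↔ ‖z‖ = 1 := by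
  change E.form (E.param z) = 1 ↔ _
  rw [form_param, pow_eq_one_iff_of_nonneg (norm_nonneg z) two_ne_zero]

lemma param_mem_inside_iff (E : PlaneEllipse) (z : ℂ) : E.param z ∈ E.inside ↔ ‖z‖ < 1 := by
  change E.form (E.param z) < 1 ↔ _
  rw [form_param, sq_lt_one_iff₀ (norm_nonneg z)]

lemma param_lineMap (E : PlaneEllipse) (z w : ℂ) (t : ℝ) :
    AffineMap.lineMap (E.param z) (E.param w) t = E.param (z + t * (w - z)) := by
  rw [AffineMap.lineMap_apply]
  simp only [param, vsub_eq_sub, vadd_eq_add, Complex.real_smul, map_add, map_mul, map_sub,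
    Complex.conj_ofReal]
  ring

/-- In the coordinate in which `E` is the unit circle, any other ellipse is again the image of the
unit circle under a nondegenerate real affine map. -/
lemma exists_param_eq (E F : PlaneEllipse) : ∃ m α β : ℂ, Complex.normSq α ≠ Complex.normSq β ∧
    ∀ w, F.param w = E.param (m + α * w + β * conj w) := by
  obtain ⟨P, hP⟩ : ∃ x : ℝ, x = (E.a + E.b) / 2 := ⟨_, rfl⟩
  obtain ⟨M, hM⟩ : ∃ x : ℝ, x = (E.a - E.b) / 2 := ⟨_, rfl⟩
  obtain ⟨P', hP'⟩ : ∃ x : ℝ, x = (F.a + F.b) / 2 := ⟨_, rfl⟩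
  obtain ⟨M', hM'⟩ : ∃ x : ℝ, x = (F.a - F.b) / 2 := ⟨_, rfl⟩
  have hPM : 0 < P ^ 2 - M ^ 2 := by
    rw [hP, hM]; nlinarith [mul_pos E.a_pos E.b_pos]
  have hPM' : 0 < P' ^ 2 - M' ^ 2 := by
    rw [hP', hM']; nlinarith [mul_pos F.a_pos F.b_pos]
  have hPMc : (P : ℂ) ^ 2 - (M : ℂ) ^ 2 ≠ 0 := by exact_mod_cast hPM.ne'
  set g := conj E.dir * F.dir with hg
  have hgg : g * conj g = 1 := by
    rw [hg, map_mul, Complex.conj_conj]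
    linear_combination (F.dir * conj F.dir) * E.dir_mul_conj + F.dir_mul_conj
  set v := conj E.dir * (F.center - E.center)
  refine ⟨(P * v - M * conj v) / (P ^ 2 - M ^ 2),
    (P * g * P' - M * conj g * M') / (P ^ 2 - M ^ 2),
    (P * g * M' - M * conj g * P') / (P ^ 2 - M ^ 2), fun h => ?_, fun w => ?_⟩
  · have h' : (Complex.normSq ((P * g * P' - M * conj g * M') / (P ^ 2 - M ^ 2)) : ℂ) =
        Complex.normSq ((P * g * M' - M * conj g * P') / (P ^ 2 - M ^ 2)) := by rw [h]
    rw [← Complex.mul_conj, ← Complex.mul_conj] at h'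
    simp only [map_div₀, map_sub, map_mul, map_pow, Complex.conj_ofReal, Complex.conj_conj] at h'
    field_simp at h'
    have h2 : (g * conj g) * (((P : ℂ) ^ 2 - M ^ 2) * ((P' : ℂ) ^ 2 - M' ^ 2)) = 0 := by
      linear_combination h'
    rw [hgg, one_mul] at h2
    have h3 : (P ^ 2 - M ^ 2) * (P' ^ 2 - M' ^ 2) = 0 := by exact_mod_cast h2
    exact (mul_pos hPM hPM').ne' h3
  · rw [param, param, ← hP, ← hM, ← hP', ← hM']
    simp only [map_add, map_div₀, map_sub, map_mul, map_pow, Complex.conj_ofReal,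
      Complex.conj_conj]
    have h1 : E.dir * v = F.center - E.center := by
      linear_combination (F.center - E.center) * E.dir_mul_conj
    have h2 : E.dir * g = F.dir := by
      linear_combination F.dir * E.dir_mul_conj
    field_simp
    linear_combination (-((P : ℂ) ^ 2 - M ^ 2)) * h1 -
      ((P : ℂ) ^ 2 - M ^ 2) * (P' * w + M' * conj w) * h2

end PlaneEllipse

/-! ### Tangency of chords -/

lemma mul_conj_eq_one {z : ℂ} (hz : ‖z‖ = 1) : z * conj z = 1 := by
  rw [Complex.mul_conj, Complex.normSq_eq_norm_sq, hz]; simp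

/-- The equation of the line through two points of the unit circle. -/
lemma exists_chord_iff {z w : ℂ} (hz : ‖z‖ = 1) (hw : ‖w‖ = 1) (hne : z ≠ w) (x : ℂ) :
    (∃ t : ℝ, x = z + t * (w - z)) ↔ x + z * w * conj x = z + w := by
  have hz' := mul_conj_eq_one hz
  have hw' := mul_conj_eq_one hw
  constructor
  · rintro ⟨t, rfl⟩
    simp only [map_add, map_mul, map_sub, Complex.conj_ofReal]
    linear_combination (w - t * w) * hz' + t * z * hw'
  · intro h
    have hd : w - z ≠ 0 := sub_ne_zero.mpr hne.symm
    have hd' : conj w - conj z ≠ 0 := by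
      rw [← map_sub]; exact (map_ne_zero _).mpr hd
    have hreal : conj ((x - z) / (w - z)) = (x - z) / (w - z) := by
      rw [map_div₀, map_sub, map_sub, div_eq_div_iff hd' hd]
      have hz0 : z ≠ 0 := left_ne_zero_of_mul_eq_one hz'
      have hw0 : w ≠ 0 := left_ne_zero_of_mul_eq_one hw'
      apply mul_left_cancel₀ (mul_ne_zero hz0 hw0)
      linear_combination (w - z) * h + ((x - z) * w - w * (w - z)) * hz' - (x - z) * z * hw'
    obtain ⟨t, ht⟩ := Complex.conj_eq_iff_real.mp hreal
    exact ⟨t, by rw [← ht]; field_simp; ring⟩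

/-- The trigonometric equation `h + g w + p conj (g w) = 0`, real up to a unimodular factor, has
exactly one solution on the unit circle if and only if its discriminant vanishes. -/
lemma existsUnique_iff_disc {h g p : ℂ} (hp : ‖p‖ = 1) (hg : g ≠ 0) (hh : p * conj h = h) :
    (∃! w : ℂ, ‖w‖ = 1 ∧ h + g * w + p * conj g * conj w = 0) ↔ h ^ 2 = 4 * (g * (p * conj g)) := by
  have hp' := mul_conj_eq_one hp
  have hp0 : p ≠ 0 := left_ne_zero_of_mul_eq_one hp'
  have hg0 : conj g ≠ 0 := by simpa using hg
  constructor
  · rintro ⟨w, ⟨hw, hwe⟩, huniq⟩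
    have hw' := mul_conj_eq_one hw
    -- Exchanging the two summands gives another solution.
    have hswap := huniq (p * conj g * conj w / g) ⟨?_, ?_⟩
    · rw [div_eq_iff hg] at hswap
      have h1 : h = -2 * (g * w) := by linear_combination hwe - hswap
      rw [h1]
      linear_combination -4 * (g * w) * hswap + 4 * g * p * conj g * hw'
    · rw [norm_div, norm_mul, norm_mul, RCLike.norm_conj, RCLike.norm_conj, hp, hw]
      simp [hg]
    · simp only [map_div₀, map_mul, Complex.conj_conj]
      field_simp
      linear_combination hwe + (g * w) * hp'
  · intro hdisc
    have hh0 : h ≠ 0 := by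
      rintro rfl
      simp [hg, hp0] at hdisc
    refine ⟨-h / (2 * g), ⟨?_, ?_⟩, ?_⟩
    · have h1 : ‖h‖ ^ 2 = (2 * ‖g‖) ^ 2 := by
        rw [← norm_pow, hdisc, norm_mul, norm_mul, norm_mul, hp, RCLike.norm_conj]
        simp; ring
      have h2 : ‖h‖ = 2 * ‖g‖ := by
        rwa [sq_eq_sq₀ (norm_nonneg _) (by positivity)] at h1
      rw [norm_div, norm_neg, norm_mul, h2]
      simp [hg]
    · simp only [map_div₀, map_neg, map_mul, Complex.conj_ofNat]
      field_simp
      linear_combination -hh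
    · rintro w ⟨hw, hwe⟩
      have hw' := mul_conj_eq_one hw
      have hsq : (h + 2 * (g * w)) ^ 2 = 0 := by
        linear_combination hdisc + 4 * g * w * hwe - 4 * g * p * conj g * hw'
      rw [eq_div_iff (mul_ne_zero two_ne_zero hg)]
      linear_combination (sq_eq_zero_iff.mp hsq)

/-- The symmetric biquadratic form in `z, w` whose vanishing says that the line through the points
`z, w` of the unit circle touches the ellipse `m + α l + β conj l`, `‖l‖ = 1`; here `s = 2m`,
`t = m² - 4αβ`, `κ = 2|m|² - 4(|α|² + |β|²)`, so that `s` and `t` are the sum and the product of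
the foci. -/
def chordForm (s t κ z w : ℂ) : ℂ :=
  (z + w) ^ 2 - s * (z + w) - conj s * (z + w) * (z * w) + t + conj t * (z * w) ^ 2 + κ * (z * w)

lemma chordForm_comm (s t κ z w : ℂ) : chordForm s t κ z w = chordForm s t κ w z := by
  rw [chordForm, chordForm]; ring

lemma chordForm_eq (m α β z w : ℂ) :
    chordForm (2 * m) (m ^ 2 - 4 * (α * β))
      (2 * (m * conj m) - 4 * (α * conj α + β * conj β)) z w =
    (m + z * w * conj m - (z + w)) ^ 2 -
      4 * ((α + z * w * conj β) * (z * w * conj (α + z * w * conj β))) +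
      4 * (α + z * w * conj β) * β * (z * w * conj (z * w) - 1) := by
  simp only [chordForm, map_sub, map_mul, map_pow, map_add, Complex.conj_ofNat, Complex.conj_conj]
  ring

lemma add_mul_conj_ne_zero {α β p : ℂ} (hαβ : Complex.normSq α ≠ Complex.normSq β)
    (hp : ‖p‖ = 1) : α + p * conj β ≠ 0 := by
  intro h
  apply hαβ
  rw [eq_neg_of_add_eq_zero_left h, Complex.normSq_neg, Complex.normSq_mul, Complex.normSq_conj,
    Complex.normSq_eq_norm_sq p, hp]
  simp

lemma existsUnique_on_chord_iff {m α β z w : ℂ} (hαβ : Complex.normSq α ≠ Complex.normSq β)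
    (hz : ‖z‖ = 1) (hw : ‖w‖ = 1) :
    (∃! l : ℂ, ‖l‖ = 1 ∧ (m + α * l + β * conj l) + z * w * conj (m + α * l + β * conj l) =
      z + w) ↔
    chordForm (2 * m) (m ^ 2 - 4 * (α * β))
      (2 * (m * conj m) - 4 * (α * conj α + β * conj β)) z w = 0 := by
  have hp : ‖z * w‖ = 1 := by rw [norm_mul, hz, hw, one_mul]
  have hp' := mul_conj_eq_one hp
  have hz' := mul_conj_eq_one hz
  have hw' := mul_conj_eq_one hw
  rw [chordForm_eq, hp', sub_self, mul_zero, add_zero, sub_eq_zero,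
    ← existsUnique_iff_disc hp (add_mul_conj_ne_zero hαβ hp)]
  · apply existsUnique_congr
    intro l
    apply and_congr_right
    intro _
    simp only [map_add, map_mul, Complex.conj_conj] at hp' ⊢
    constructor <;> intro h
    · linear_combination h + (β * conj l) * hp'
    · linear_combination h - (β * conj l) * hp'
  · simp only [map_add, map_sub, map_mul, Complex.conj_conj]
    linear_combination (m * w * conj w) * hz' + m * hw' - w * hz' - z * hw'

lemma PlaneEllipse.isTangentLine_iff {E F : PlaneEllipse} {m α β : ℂ}
    (hαβ : Complex.normSq α ≠ Complex.normSq β)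
    (hF : ∀ w, F.param w = E.param (m + α * w + β * conj w))
    {z w : ℂ} (hz : ‖z‖ = 1) (hw : ‖w‖ = 1) (hne : z ≠ w) :
    F.IsTangentLine line[ℝ, E.param z, E.param w] ↔
      chordForm (2 * m) (m ^ 2 - 4 * (α * β))
        (2 * (m * conj m) - 4 * (α * conj α + β * conj β)) z w = 0 := by
  rw [← existsUnique_on_chord_iff hαβ hz hw, IsTangentLine]
  have hb : Function.Bijective F.param := ⟨F.param_injective, F.param_surjective⟩
  rw [hb.existsUnique_iff]
  apply existsUnique_congr
  intro l
  rw [F.param_mem_curve_iff, and_comm, mem_affineSpan_pair_iff_exists_lineMap_eq]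
  apply and_congr_right
  intro _
  simp only [PlaneEllipse.param_lineMap, hF]
  rw [← exists_chord_iff hz hw hne]
  apply exists_congr
  intro t
  rw [E.param_injective.eq_iff, eq_comm]

/-- If the ellipse lies inside the unit circle then no tangent of the unit circle touches it. -/
lemma chordForm_self_ne_zero {m α β z : ℂ} (hαβ : Complex.normSq α ≠ Complex.normSq β)
    (hin : ∀ l : ℂ, ‖l‖ = 1 → ‖m + α * l + β * conj l‖ < 1) (hz : ‖z‖ = 1) :
    chordForm (2 * m) (m ^ 2 - 4 * (α * β))
      (2 * (m * conj m) - 4 * (α * conj α + β * conj β)) z z ≠ 0 := by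
  intro h
  obtain ⟨l, ⟨hl, he⟩, -⟩ := (existsUnique_on_chord_iff hαβ hz hz).mpr h
  have h1 := hin l hl
  have h2 : ‖z + z‖ = 2 := by rw [← two_mul, norm_mul, hz]; simp
  rw [← he] at h2
  have h3 := norm_add_le (m + α * l + β * conj l) (z * z * conj (m + α * l + β * conj l))
  rw [h2, norm_mul, norm_mul, hz, RCLike.norm_conj] at h3
  linarith

/-! ### Poncelet triples on the unit circle -/

/-- Three distinct points of the unit circle whose chords touch the inner ellipse are the roots of
a cubic of Blaschke type. The condition on `κ` is the closing condition for triangles. -/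
lemma vieta_of_chordForm {s t κ z₁ z₂ z₃ : ℂ} (h₁ : z₁ ≠ 0) (h₂ : z₂ ≠ 0)
    (h₁₂ : z₁ ≠ z₂) (h₁₃ : z₁ ≠ z₃) (h₂₃ : z₂ ≠ z₃)
    (g₁₂ : chordForm s t κ z₁ z₂ = 0) (g₁₃ : chordForm s t κ z₁ z₃ = 0)
    (g₂₃ : chordForm s t κ z₂ z₃ = 0) :
    z₁ + z₂ + z₃ = s + z₁ * z₂ * z₃ * conj t ∧
      z₁ * z₂ + z₁ * z₃ + z₂ * z₃ = t + z₁ * z₂ * z₃ * conj s ∧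
      κ = s * conj s - t * conj t - 1 := by
  -- For fixed `x`, the equation is quadratic in the second variable; this is the product of its
  -- two roots `y` and `z`.
  have hprod : ∀ x y z : ℂ, y ≠ z → chordForm s t κ x y = 0 → chordForm s t κ x z = 0 →
      (1 - conj s * x + conj t * x ^ 2) * (y * z) = x ^ 2 - s * x + t := by
    intro x y z hyz hy hz
    apply mul_left_cancel₀ (sub_ne_zero.mpr hyz)
    rw [chordForm] at hy hz
    linear_combination z * hy - y * hz
  have e₁ := hprod z₁ z₂ z₃ h₂₃ g₁₂ g₁₃
  have e₂ := hprod z₂ z₁ z₃ h₁₃ (by rwa [chordForm_comm]) g₂₃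
  set d₁ := z₁ + z₂ + z₃ - (s + z₁ * z₂ * z₃ * conj t) with hd₁
  set d₂ := t + z₁ * z₂ * z₃ * conj s - (z₁ * z₂ + z₁ * z₃ + z₂ * z₃) with hd₂
  have f₁ : d₁ * z₁ + d₂ = 0 := by
    rw [hd₁, hd₂]
    linear_combination -e₁
  have f₂ : d₁ * z₂ + d₂ = 0 := by
    rw [hd₁, hd₂]
    linear_combination -e₂
  have hd₁0 : d₁ = 0 := by
    apply mul_right_cancel₀ (sub_ne_zero.mpr h₁₂)
    linear_combination f₁ - f₂
  have hd₂0 : d₂ = 0 := by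
    rw [hd₁0] at f₁; linear_combination f₁
  have s₁ : z₁ + z₂ + z₃ = s + z₁ * z₂ * z₃ * conj t := by linear_combination hd₁0 - hd₁
  have s₂ : z₁ * z₂ + z₁ * z₃ + z₂ * z₃ = t + z₁ * z₂ * z₃ * conj s := by
    linear_combination hd₂ - hd₂0
  refine ⟨s₁, s₂, ?_⟩
  have hs : s = z₁ + z₂ + z₃ - z₁ * z₂ * z₃ * conj t := by linear_combination -s₁
  have ht : t = z₁ * z₂ + z₁ * z₃ + z₂ * z₃ - z₁ * z₂ * z₃ * conj s := by linear_combination -s₂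
  apply mul_left_cancel₀ (mul_ne_zero h₁ h₂)
  rw [chordForm] at g₁₂
  generalize conj s = s' at *
  generalize conj t = t' at *
  subst hs
  rw [ht] at g₁₂ ⊢
  linear_combination g₁₂

/-- Conversely, under the closing condition, the roots of a cubic of that type form a Poncelet
triple. -/
lemma chordForm_of_vieta {s t κ l z₁ z₂ z₃ : ℂ}
    (s₁ : z₁ + z₂ + z₃ = s + l * conj t) (s₂ : z₁ * z₂ + z₁ * z₃ + z₂ * z₃ = t + l * conj s)
    (s₃ : z₁ * z₂ * z₃ = l) (hκ : κ = s * conj s - t * conj t - 1) :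
    chordForm s t κ z₁ z₂ = 0 := by
  have hs : s = z₁ + z₂ + z₃ - l * conj t := by linear_combination -s₁
  have ht : t = z₁ * z₂ + z₁ * z₃ + z₂ * z₃ - l * conj s := by linear_combination -s₂
  rw [chordForm, hκ]
  generalize conj s = s' at *
  generalize conj t = t' at *
  subst hs
  rw [ht, ← s₃]
  ring

lemma exists_cubic_roots (a b c : ℂ) :
    ∃ z₁ z₂ z₃ : ℂ, z₁ + z₂ + z₃ = a ∧ z₁ * z₂ + z₁ * z₃ + z₂ * z₃ = b ∧ z₁ * z₂ * z₃ = c := by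
  open Polynomial in
  obtain ⟨z₁, hz₁⟩ := IsAlgClosed.exists_root (X ^ 3 - C a * X ^ 2 + C b * X - C c : ℂ[X]) (by
    have : (X ^ 3 - C a * X ^ 2 + C b * X - C c : ℂ[X]).degree = 3 := by compute_degree!
    rw [this]; norm_num)
  simp only [Polynomial.IsRoot.def, Polynomial.eval_sub, Polynomial.eval_add, Polynomial.eval_pow,
    Polynomial.eval_mul, Polynomial.eval_C, Polynomial.eval_X] at hz₁
  obtain ⟨r, hr⟩ := IsAlgClosed.exists_pow_nat_eq ((a - z₁) ^ 2 - 4 * (b - z₁ * (a - z₁)))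
    (n := 2) (by norm_num)
  refine ⟨z₁, (a - z₁ + r) / 2, (a - z₁ - r) / 2, by ring, ?_, ?_⟩
  · linear_combination (-1 / 4) * hr
  · linear_combination hz₁ - z₁ / 4 * hr

/-- The squared comparison behind the Blaschke factor `(z - f) / (1 - conj f z)`. -/
lemma normSq_one_sub_sub_normSq_sub (f z : ℂ) :
    ‖1 - conj f * z‖ ^ 2 - ‖z - f‖ ^ 2 = (1 - ‖f‖ ^ 2) * (1 - ‖z‖ ^ 2) := by
  simp only [Complex.sq_norm, Complex.normSq_apply]
  simp
  ring

/-- A Blaschke product of degree three is unimodular only on the unit circle. -/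
lemma norm_eq_one_of_blaschke {f g l z : ℂ} (hf : ‖f‖ < 1) (hg : ‖g‖ < 1) (hl : ‖l‖ = 1)
    (h : l * ((1 - conj f * z) * (1 - conj g * z)) = z * ((z - f) * (z - g))) : ‖z‖ = 1 := by
  have hn : ‖1 - conj f * z‖ * ‖1 - conj g * z‖ = ‖z‖ * (‖z - f‖ * ‖z - g‖) := by
    have := congrArg norm h
    simpa only [norm_mul, hl, one_mul] using this
  have hf' := normSq_one_sub_sub_normSq_sub f z
  have hg' := normSq_one_sub_sub_normSq_sub g z
  have hf1 : 0 < 1 - ‖f‖ ^ 2 := by nlinarith [norm_nonneg f]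
  have hg1 : 0 < 1 - ‖g‖ ^ 2 := by nlinarith [norm_nonneg g]
  rcases lt_trichotomy ‖z‖ 1 with hz | hz | hz
  · exfalso
    have hz1 : 0 < 1 - ‖z‖ ^ 2 := by nlinarith [norm_nonneg z]
    have a₁ : ‖z - f‖ < ‖1 - conj f * z‖ :=
      lt_of_pow_lt_pow_left₀ 2 (norm_nonneg _) (by nlinarith [mul_pos hf1 hz1])
    have a₂ : ‖z - g‖ < ‖1 - conj g * z‖ :=
      lt_of_pow_lt_pow_left₀ 2 (norm_nonneg _) (by nlinarith [mul_pos hg1 hz1])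
    have a₃ := mul_lt_mul'' a₁ a₂ (norm_nonneg _) (norm_nonneg _)
    have a₄ : 0 ≤ ‖z - f‖ * ‖z - g‖ := by positivity
    nlinarith
  · exact hz
  · exfalso
    have hz1 : 1 - ‖z‖ ^ 2 < 0 := by nlinarith [norm_nonneg z]
    have a₁ : ‖1 - conj f * z‖ < ‖z - f‖ :=
      lt_of_pow_lt_pow_left₀ 2 (norm_nonneg _) (by nlinarith [mul_neg_of_pos_of_neg hf1 hz1])
    have a₂ : ‖1 - conj g * z‖ < ‖z - g‖ :=
      lt_of_pow_lt_pow_left₀ 2 (norm_nonneg _) (by nlinarith [mul_neg_of_pos_of_neg hg1 hz1])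
    have a₃ := mul_lt_mul'' a₁ a₂ (norm_nonneg _) (norm_nonneg _)
    have a₄ : 0 ≤ ‖1 - conj f * z‖ * ‖1 - conj g * z‖ := by positivity
    nlinarith

/-- The foci `m ± 2δ`, `δ² = αβ`, of the ellipse `m + α l + β conj l` lie on the segment between
the ends of its major axis, hence in any disk that contains the ellipse. -/
lemma norm_focus_lt_one {m α β δ : ℂ}
    (hin : ∀ l : ℂ, ‖l‖ = 1 → ‖m + α * l + β * conj l‖ < 1) (hδ : δ ^ 2 = α * β) :
    ‖m + 2 * δ‖ < 1 := by
  -- It is enough to exhibit `2δ` as a point of a segment between opposite points.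
  obtain ⟨l, a, hl, ha, ha1, h2δ⟩ : ∃ (l : ℂ) (a : ℝ), ‖l‖ = 1 ∧ 0 ≤ a ∧ a ≤ 1 ∧
      2 * δ = a * (α * l + β * conj l) := by
    by_cases h0 : δ = 0
    · exact ⟨1, 0, by simp, le_rfl, zero_le_one, by simp [h0]⟩
    · have hα : α ≠ 0 := by rintro rfl; simp at hδ; exact h0 hδ
      have hβ : β ≠ 0 := by rintro rfl; simp at hδ; exact h0 hδ
      have hnα : 0 < ‖α‖ := norm_pos_iff.mpr hα
      have hnβ : 0 < ‖β‖ := norm_pos_iff.mpr hβ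
      have hnδ : 0 < ‖δ‖ := norm_pos_iff.mpr h0
      have hcα : (‖α‖ : ℂ) ≠ 0 := by exact_mod_cast hnα.ne'
      have hcδ : (‖δ‖ : ℂ) ≠ 0 := by exact_mod_cast hnδ.ne'
      have hnorm : ‖δ‖ ^ 2 = ‖α‖ * ‖β‖ := by rw [← norm_pow, hδ, norm_mul]
      have hnormc : (‖δ‖ : ℂ) ^ 2 = ‖α‖ * ‖β‖ := by exact_mod_cast hnorm
      have hsum : (‖α‖ : ℂ) + ‖β‖ ≠ 0 := by exact_mod_cast (add_pos hnα hnβ).ne'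
      have hl : ‖(‖α‖ * δ / (α * ‖δ‖) : ℂ)‖ = 1 := by
        simp only [norm_div, norm_mul, Complex.norm_real, norm_norm]
        field_simp
      have hconj : conj (‖α‖ * δ / (α * ‖δ‖) : ℂ) = α * ‖δ‖ / (‖α‖ * δ) := by
        apply mul_left_cancel₀ (left_ne_zero_of_mul_eq_one (mul_conj_eq_one hl))
        rw [mul_conj_eq_one hl]
        field_simp
      refine ⟨‖α‖ * δ / (α * ‖δ‖), 2 * ‖δ‖ / (‖α‖ + ‖β‖), hl, by positivity, ?_, ?_⟩
      · rw [div_le_one (by positivity)]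
        nlinarith [sq_nonneg (‖α‖ - ‖β‖)]
      · rw [hconj]
        have : α * (‖α‖ * δ / (α * ‖δ‖)) + β * (α * ‖δ‖ / (‖α‖ * δ)) =
            (‖α‖ + ‖β‖) * δ / ‖δ‖ := by
          field_simp
          linear_combination (-(‖δ‖ : ℂ) ^ 2) * hδ + δ ^ 2 * hnormc
        rw [this]
        push_cast
        field_simp
  have h1 := hin l hl
  have h2 := hin (-l) (by rwa [norm_neg])
  have hconv := convex_ball (0 : ℂ) 1 (mem_ball_zero_iff.mpr h1) (mem_ball_zero_iff.mpr h2)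
    (show 0 ≤ (1 + a) / 2 by linarith) (show 0 ≤ (1 - a) / 2 by linarith) (by ring)
  rw [mem_ball_zero_iff] at hconv
  have hcomb : m + 2 * δ = ((1 + a) / 2) • (m + α * l + β * conj l) +
      ((1 - a) / 2) • (m + α * -l + β * conj (-l)) := by
    rw [h2δ]
    simp only [Complex.real_smul, map_neg]
    push_cast
    ring
  rw [hcomb]
  exact hconv

/-! ### The circumcircles of a Poncelet family -/

lemma netPower_cast (q : ℝ) (c₀ A B P l : ℂ) :
    (netPower q c₀ A B P l : ℂ) = P * conj P - conj P * ellipsePoint c₀ A B l -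
      P * conj (ellipsePoint c₀ A B l) + q := by
  apply Complex.ext
  · simp [netPower, Complex.normSq_apply]; ring
  · simp; ring

lemma netPower_sub_eq_zero_iff {q : ℝ} (hq : q < 0) (c₀ A B Q Z l : ℂ) :
    netPower q c₀ A B (Z - Q) l = 0 ↔
      dist Z (Q + ellipsePoint c₀ A B l) = √(Complex.normSq (ellipsePoint c₀ A B l) - q) := by
  have h0 : 0 ≤ Complex.normSq (ellipsePoint c₀ A B l) - q := by
    linarith [Complex.normSq_nonneg (ellipsePoint c₀ A B l)]
  have key : netPower q c₀ A B (Z - Q) l = dist Z (Q + ellipsePoint c₀ A B l) ^ 2 -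
      (Complex.normSq (ellipsePoint c₀ A B l) - q) := by
    rw [Complex.dist_eq, Complex.sq_norm, netPower]
    generalize ellipsePoint c₀ A B l = e
    simp [Complex.normSq_apply]; ring
  rw [key, sub_eq_zero]
  constructor
  · intro h
    rw [← h, Real.sqrt_sq dist_nonneg]
  · intro h
    rw [h, Real.sq_sqrt h0]

/-- The radical centre of the circumcircles, in the coordinate in which the outer ellipse is the
unit circle and the foci of the inner one are `f` and `g`: it lies in the unit disk. -/
lemma exists_radical_center {f g : ℂ} (hf : ‖f‖ < 1) (hg : ‖g‖ < 1) :
    ∃ ζ : ℂ, ‖ζ‖ < 1 ∧ ζ + f * g * conj ζ = f + g := by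
  have hF := norm_nonneg f
  have hG := norm_nonneg g
  have hfg : 0 < 1 - (‖f‖ * ‖g‖) ^ 2 := by
    have : ‖f‖ * ‖g‖ < 1 := mul_lt_one_of_nonneg_of_lt_one_left hF hf hg.le
    nlinarith [mul_nonneg hF hG]
  have hff : f * conj f = (‖f‖ : ℂ) ^ 2 := by rw [Complex.mul_conj, Complex.normSq_eq_norm_sq]; simp
  have hgg : g * conj g = (‖g‖ : ℂ) ^ 2 := by rw [Complex.mul_conj, Complex.normSq_eq_norm_sq]; simp
  have hfgc : ((1 - (‖f‖ * ‖g‖) ^ 2 : ℝ) : ℂ) ≠ 0 := by exact_mod_cast hfg.ne'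
  refine ⟨(f * (1 - ‖g‖ ^ 2 : ℝ) + g * (1 - ‖f‖ ^ 2 : ℝ)) / (1 - (‖f‖ * ‖g‖) ^ 2 : ℝ), ?_, ?_⟩
  · rw [norm_div, Complex.norm_real, Real.norm_of_nonneg hfg.le, div_lt_one hfg]
    refine (norm_add_le _ _).trans_lt ?_
    rw [norm_mul, norm_mul, Complex.norm_real, Complex.norm_real,
      Real.norm_of_nonneg (by nlinarith), Real.norm_of_nonneg (by nlinarith)]
    have h1 : 0 < (1 - ‖f‖) * (1 - ‖g‖) := mul_pos (by linarith) (by linarith)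
    have h2 : 0 < 1 - ‖f‖ * ‖g‖ := by nlinarith
    nlinarith [mul_pos h1 h2]
  · simp only [map_div₀, map_add, map_mul, Complex.conj_ofReal]
    rw [← mul_div_assoc, ← add_div, div_eq_iff hfgc]
    push_cast
    linear_combination (g - g * (‖g‖ : ℂ) ^ 2) * hff + (f - f * (‖f‖ : ℂ) ^ 2) * hgg

/-- The key computation: if `z` is a vertex of the Poncelet triangle with parameter `l`, read on
the unit circle, then the point of the ellipse corresponding to `z` lies on the circle of the net
with parameter `l`. Behind it is the fact that a circle meets an ellipse in four points whose
parameters on the unit circle have product `1`, so that the fourth one is `conj l`. -/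
lemma netPower_param_eq_zero (E : PlaneEllipse) {s t ζ l z : ℂ} {P M k : ℝ}
    (hP : P = (E.a + E.b) / 2) (hM : M = (E.a - E.b) / 2) (hk : k * (P ^ 2 - M ^ 2) = P * M)
    (hζ : ζ + t * conj ζ = s) (hl : ‖l‖ = 1) (hz : ‖z‖ = 1)
    (hcubic : z ^ 3 - (s + l * conj t) * z ^ 2 + (t + l * conj s) * z - l = 0) :
    netPower (-((1 - ‖ζ‖ ^ 2) * (P ^ 2 + M ^ 2 - 2 * (P * M * t.re))))
      (E.dir * (k * (P * conj s - M * s) - P * ζ - M * conj ζ))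
      (E.dir * (k * (P - M * conj t))) (E.dir * (k * (P * t - M)))
      (E.param z - E.param ζ) l = 0 := by
  have hz' := mul_conj_eq_one hz
  have hl' := mul_conj_eq_one hl
  have hz0 : z ≠ 0 := left_ne_zero_of_mul_eq_one hz'
  have hd := E.dir_mul_conj
  have hkc : (k : ℂ) * (P ^ 2 - M ^ 2) = P * M := by exact_mod_cast hk
  have hζc : conj ζ + conj t * ζ = conj s := by
    rw [← hζ]; simp
  have hnζ : (‖ζ‖ : ℂ) ^ 2 = ζ * conj ζ := by
    rw [Complex.mul_conj, Complex.normSq_eq_norm_sq]; simp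
  have htr : (2 * t.re : ℂ) = t + conj t := by rw [Complex.add_conj]; push_cast; ring
  have hbracket : z ^ 2 + conj z ^ 2 - z * (s + l * conj t + conj l) -
      conj z * (conj s + conj l * t + l) + (t + conj t + l * conj s + conj l * s) = 0 := by
    apply mul_left_cancel₀ (pow_ne_zero 2 hz0)
    linear_combination (z - conj l) * hcubic +
      (z * conj z + 1 - z * (conj s + conj l * t + l)) * hz' +
      (-conj t * z ^ 2 + conj s * z - 1) * hl'
  have hv : E.param z - E.param ζ =
      E.dir * (P * (z - ζ) + M * (conj z - conj ζ)) := by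
    rw [PlaneEllipse.param, PlaneEllipse.param, ← hP, ← hM]; ring
  have he : ellipsePoint (E.dir * (k * (P * conj s - M * s) - P * ζ - M * conj ζ))
      (E.dir * (k * (P - M * conj t))) (E.dir * (k * (P * t - M))) l =
      E.dir * (k * (P * (conj s + conj l * t + l) - M * (s + l * conj t + conj l)) -
        P * ζ - M * conj ζ) := by
    rw [ellipsePoint]; ring
  have hcast := netPower_cast (-((1 - ‖ζ‖ ^ 2) * (P ^ 2 + M ^ 2 - 2 * (P * M * t.re))))
      (E.dir * (k * (P * conj s - M * s) - P * ζ - M * conj ζ))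
      (E.dir * (k * (P - M * conj t))) (E.dir * (k * (P * t - M)))
      (E.param z - E.param ζ) l
  have hq : ((-((1 - ‖ζ‖ ^ 2) * (P ^ 2 + M ^ 2 - 2 * (P * M * t.re))) : ℝ) : ℂ) =
      -((1 - ζ * conj ζ) * (P ^ 2 + M ^ 2 - P * M * (t + conj t))) := by
    push_cast; rw [hnζ, ← htr]; ring
  rw [hv, he, hq] at hcast
  rw [hv]
  apply Complex.ofReal_injective
  rw [hcast]
  simp only [map_add, map_sub, map_mul, Complex.conj_ofReal, Complex.conj_conj, Complex.ofReal_zero]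
  generalize conj z = z' at *
  generalize conj l = l' at *
  generalize conj s = s' at *
  generalize conj t = t' at *
  generalize conj ζ = ζ' at *
  generalize conj E.dir = d' at *
  obtain ⟨v, hv⟩ : ∃ v : ℂ, v = P * (z - ζ) + M * (z' - ζ') := ⟨_, rfl⟩
  obtain ⟨v', hv'⟩ : ∃ v : ℂ, v = P * (z' - ζ') + M * (z - ζ) := ⟨_, rfl⟩
  obtain ⟨y, hy⟩ : ∃ y : ℂ, y = k * (P * (s' + l' * t + l) - M * (s + l * t' + l')) -
        P * ζ - M * ζ' := ⟨_, rfl⟩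
  obtain ⟨y', hy'⟩ : ∃ y : ℂ, y = k * (P * (s + l * t' + l') - M * (s' + l' * t + l)) -
        P * ζ' - M * ζ := ⟨_, rfl⟩
  rw [← hv, ← hv', ← hy, ← hy']
  have main : v * v' - v' * y - v * y' -
      (1 - ζ * ζ') * (P ^ 2 + M ^ 2 - P * M * (t + t')) = 0 := by
    rw [hv, hv', hy, hy']
    linear_combination ((P : ℂ) ^ 2 + M ^ 2) * hz' + P * M * hbracket +
      P * M * (l' - ζ) * hζ + P * M * (l - ζ') * hζc +
      ((ζ - z) * (s + l * t' + l') + (ζ' - z') * (s' + l' * t + l)) * hkc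
  linear_combination main + (v * v' - v' * y - v * y') * hd

/-- The ellipse of the circumcentres is nondegenerate. -/
lemma normSq_coeff_ne {P M k : ℝ} {d t : ℂ} (hd : ‖d‖ = 1) (hk : k ≠ 0)
    (hPM : P ^ 2 - M ^ 2 ≠ 0) (ht : ‖t‖ < 1) :
    Complex.normSq (d * (k * (P - M * conj t))) ≠ Complex.normSq (d * (k * (P * t - M))) := by
  intro h
  rw [Complex.normSq_mul, Complex.normSq_mul, Complex.normSq_mul, Complex.normSq_mul,
    Complex.normSq_eq_norm_sq d, hd, Complex.normSq_ofReal, one_pow, one_mul, one_mul] at h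
  have h1 := mul_left_cancel₀ (mul_ne_zero hk hk) h
  have h2 : (P ^ 2 - M ^ 2) * (1 - ‖t‖ ^ 2) = 0 := by
    rw [Complex.sq_norm, Complex.normSq_apply]
    simp [Complex.normSq_apply] at h1
    linear_combination h1
  rcases mul_eq_zero.mp h2 with h3 | h3
  · exact hPM h3
  · nlinarith [norm_nonneg t]

lemma forall_ne_fin_three {p : Fin 3 → Fin 3 → Prop} (hsymm : ∀ i j, p i j → p j i)
    (h₀₁ : p 0 1) (h₀₂ : p 0 2) (h₁₂ : p 1 2) : ∀ i j, i ≠ j → p i j := by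
  intro i j hij
  fin_cases i <;> fin_cases j <;> first | exact absurd rfl hij | assumption |
    (apply hsymm; assumption)

/-- Any pair of nested ellipses admitting a Poncelet triangle, the outer one not a circle, gives
rise to a net of circles with a common negative power `q` at a point `Q` and with centres on an
ellipse, which are exactly the circumcircles of the Poncelet triangles. -/
theorem exists_circumcircle_net {E Ec : PlaneEllipse} (hE : ¬ E.IsCircle) (hnest : Ec.NestedIn E)
    (hfam : (ponceletFamily E Ec).Nonempty) :
    ∃ (Q c₀ A B : ℂ) (q : ℝ), q < 0 ∧ Complex.normSq A ≠ Complex.normSq B ∧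
      (∀ T ∈ ponceletFamily E Ec, ∃ l, ‖l‖ = 1 ∧
        ∀ i, netPower q c₀ A B (T.points i - Q) l = 0) ∧
      (∀ l, ‖l‖ = 1 → ∃ T ∈ ponceletFamily E Ec,
        ∀ i, netPower q c₀ A B (T.points i - Q) l = 0) := by
  obtain ⟨m, α, β, hαβ, hEc⟩ := E.exists_param_eq Ec
  have hin : ∀ l : ℂ, ‖l‖ = 1 → ‖m + α * l + β * conj l‖ < 1 := by
    intro l hl
    rw [← E.param_mem_inside_iff, ← hEc]
    exact hnest ((Ec.param_mem_curve_iff l).mpr hl)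
  obtain ⟨δ, hδ⟩ := IsAlgClosed.exists_pow_nat_eq (α * β) (n := 2) (by norm_num)
  have hf : ‖m + 2 * δ‖ < 1 := norm_focus_lt_one hin hδ
  have hg : ‖m - 2 * δ‖ < 1 := by
    have := norm_focus_lt_one (δ := -δ) hin (by rw [neg_sq, hδ])
    rwa [mul_neg, ← sub_eq_add_neg] at this
  obtain ⟨s, hs⟩ : ∃ s, s = 2 * m := ⟨_, rfl⟩
  obtain ⟨t, ht⟩ : ∃ t, t = m ^ 2 - 4 * (α * β) := ⟨_, rfl⟩
  obtain ⟨κ, hκ⟩ : ∃ κ, κ = 2 * (m * conj m) - 4 * (α * conj α + β * conj β) := ⟨_, rfl⟩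
  have hfgs : (m + 2 * δ) + (m - 2 * δ) = s := by rw [hs]; ring
  have hfgt : (m + 2 * δ) * (m - 2 * δ) = t := by rw [ht, ← hδ]; ring
  have htan : ∀ {z w : ℂ}, ‖z‖ = 1 → ‖w‖ = 1 → z ≠ w →
      (Ec.IsTangentLine line[ℝ, E.param z, E.param w] ↔ chordForm s t κ z w = 0) := by
    intro z w hz hw hne
    rw [hs, ht, hκ]
    exact PlaneEllipse.isTangentLine_iff hαβ hEc hz hw hne
  have hself : ∀ {z : ℂ}, ‖z‖ = 1 → chordForm s t κ z z ≠ 0 := by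
    intro z hz
    rw [hs, ht, hκ]
    exact chordForm_self_ne_zero hαβ hin hz
  have ht1 : ‖t‖ < 1 := by
    rw [← hfgt, norm_mul]
    exact mul_lt_one_of_nonneg_of_lt_one_left (norm_nonneg _) hf hg.le
  obtain ⟨ζ, hζ1, hζ⟩ := exists_radical_center hf hg
  rw [hfgt, hfgs] at hζ
  -- The vertices of a Poncelet triangle, read on the unit circle.
  have hvert : ∀ T ∈ ponceletFamily E Ec, ∃ z : Fin 3 → ℂ, (∀ i, T.points i = E.param (z i)) ∧
      (∀ i, ‖z i‖ = 1) ∧ z 0 + z 1 + z 2 = s + z 0 * z 1 * z 2 * conj t ∧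
      z 0 * z 1 + z 0 * z 2 + z 1 * z 2 = t + z 0 * z 1 * z 2 * conj s ∧
      κ = s * conj s - t * conj t - 1 := by
    rintro T ⟨hT, hTtan⟩
    choose z hz using fun i => E.param_surjective (T.points i)
    have hz1 : ∀ i, ‖z i‖ = 1 := by
      intro i
      rw [← E.param_mem_curve_iff, hz]
      exact hT i
    have hinj : ∀ {i j}, i ≠ j → z i ≠ z j := by
      intro i j hij h
      apply T.independent.injective.ne hij
      rw [← hz, ← hz, h]
    have hz0 : ∀ i, z i ≠ 0 := by
      intro i h
      have := hz1 i
      simp [h] at this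
    have hchord : ∀ {i j}, i ≠ j → chordForm s t κ (z i) (z j) = 0 := by
      intro i j hij
      rw [← htan (hz1 i) (hz1 j) (hinj hij), hz, hz]
      exact hTtan i j hij
    exact ⟨z, fun i => (hz i).symm, hz1, vieta_of_chordForm (hz0 0) (hz0 1) (hinj (by decide))
      (hinj (by decide)) (hinj (by decide)) (hchord (by decide)) (hchord (by decide))
      (hchord (by decide))⟩
  have hclose : κ = s * conj s - t * conj t - 1 := by
    obtain ⟨T, hT⟩ := hfam
    obtain ⟨-, -, -, -, -, h⟩ := hvert T hT
    exact h
  obtain ⟨P, hP⟩ : ∃ P : ℝ, P = (E.a + E.b) / 2 := ⟨_, rfl⟩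
  obtain ⟨M, hM⟩ : ∃ M : ℝ, M = (E.a - E.b) / 2 := ⟨_, rfl⟩
  have ha := E.a_pos
  have hb := E.b_pos
  have hP0 : 0 < P := by rw [hP]; positivity
  have hM0 : M ≠ 0 := by
    rw [hM]
    exact div_ne_zero (sub_ne_zero.mpr hE) two_ne_zero
  have hPM : 0 < P ^ 2 - M ^ 2 := by
    rw [hP, hM]; nlinarith [mul_pos ha hb]
  have hk : P * M / (P ^ 2 - M ^ 2) * (P ^ 2 - M ^ 2) = P * M := div_mul_cancel₀ _ hPM.ne'
  have hk0 : P * M / (P ^ 2 - M ^ 2) ≠ 0 := div_ne_zero (mul_ne_zero hP0.ne' hM0) hPM.ne'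
  generalize P * M / (P ^ 2 - M ^ 2) = k at hk hk0
  have hq : -((1 - ‖ζ‖ ^ 2) * (P ^ 2 + M ^ 2 - 2 * (P * M * t.re))) < 0 := by
    have h1 : 0 < 1 - ‖ζ‖ ^ 2 := by nlinarith [norm_nonneg ζ]
    have h2 : |t.re| < 1 := (Complex.abs_re_le_norm t).trans_lt ht1
    have h3 := abs_lt.mp h2
    have h4 : 0 < P ^ 2 + M ^ 2 - 2 * (P * M * t.re) := by
      have : P ^ 2 + M ^ 2 - 2 * (P * M * t.re) =
          (1 - t.re) / 2 * (P + M) ^ 2 + (1 + t.re) / 2 * (P - M) ^ 2 := by ring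
      rw [this]
      have h5 : 0 < (P + M) ^ 2 := by
        rw [hP, hM, show (E.a + E.b) / 2 + (E.a - E.b) / 2 = E.a by ring]; positivity
      have h6 : 0 < (P - M) ^ 2 := by
        rw [hP, hM, show (E.a + E.b) / 2 - (E.a - E.b) / 2 = E.b by ring]; positivity
      have h7 : 0 < (1 - t.re) / 2 := by linarith
      have h8 : 0 < (1 + t.re) / 2 := by linarith
      positivity
    rw [neg_lt_zero]
    exact mul_pos h1 h4
  refine ⟨E.param ζ, E.dir * (k * (P * conj s - M * s) - P * ζ - M * conj ζ), _, _, _, hq,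
    normSq_coeff_ne E.norm_dir hk0 hPM.ne' ht1, ?_, ?_⟩
  · intro T hT
    obtain ⟨z, hz, hz1, s₁, s₂, -⟩ := hvert T hT
    have hl : ‖z 0 * z 1 * z 2‖ = 1 := by simp [hz1]
    refine ⟨z 0 * z 1 * z 2, hl, fun i => ?_⟩
    rw [hz]
    refine netPower_param_eq_zero E hP hM hk hζ hl (hz1 i) ?_
    rw [← s₁, ← s₂]
    fin_cases i <;> simp only [Fin.zero_eta, Fin.mk_one, Fin.reduceFinMk] <;> ring
  · intro l hl
    obtain ⟨z₁, z₂, z₃, s₁, s₂, s₃⟩ := exists_cubic_roots (s + l * conj t) (t + l * conj s) l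
    have hroot : ∀ i, (![z₁, z₂, z₃] i) ^ 3 - (s + l * conj t) * (![z₁, z₂, z₃] i) ^ 2 +
        (t + l * conj s) * (![z₁, z₂, z₃] i) - l = 0 := by
      intro i
      rw [← s₁, ← s₂, ← s₃]
      fin_cases i <;> simp <;> ring
    have hz1 : ∀ i, ‖![z₁, z₂, z₃] i‖ = 1 := by
      intro i
      refine norm_eq_one_of_blaschke hf hg hl ?_
      have h1 := congrArg conj hfgs
      have h2 := congrArg conj hfgt
      rw [map_add] at h1
      rw [map_mul] at h2
      linear_combination -hroot i + (-l * ![z₁, z₂, z₃] i) * h1 + l * ![z₁, z₂, z₃] i ^ 2 * h2 +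
        ![z₁, z₂, z₃] i ^ 2 * hfgs - ![z₁, z₂, z₃] i * hfgt
    have g₁₂ : chordForm s t κ z₁ z₂ = 0 := chordForm_of_vieta s₁ s₂ s₃ hclose
    have g₁₃ : chordForm s t κ z₁ z₃ = 0 :=
      chordForm_of_vieta (z₃ := z₂) (by rw [← s₁]; ring) (by rw [← s₂]; ring) (by rw [← s₃]; ring)
        hclose
    have g₂₃ : chordForm s t κ z₂ z₃ = 0 :=
      chordForm_of_vieta (z₃ := z₁) (by rw [← s₁]; ring) (by rw [← s₂]; ring) (by rw [← s₃]; ring)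
        hclose
    have hchord : ∀ i j, i ≠ j → chordForm s t κ (![z₁, z₂, z₃] i) (![z₁, z₂, z₃] j) = 0 :=
      forall_ne_fin_three (fun i j h => by rwa [chordForm_comm]) g₁₂ g₁₃ g₂₃
    -- A double root would give a common tangent of the unit circle and the inner ellipse.
    have hne : ∀ i j, i ≠ j → ![z₁, z₂, z₃] i ≠ ![z₁, z₂, z₃] j := by
      intro i j hij h
      have := hchord i j hij
      rw [← h] at this
      exact hself (hz1 i) this
    generalize ![z₁, z₂, z₃] = z at *
    have hpow := fun i => netPower_param_eq_zero E hP hM hk hζ hl (hz1 i) (hroot i)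
    have hcosph : EuclideanGeometry.Cospherical (Set.range fun i => E.param (z i)) :=
      ⟨_, _, Set.forall_mem_range.mpr fun i =>
        (netPower_sub_eq_zero_iff hq _ _ _ _ _ _).mp (hpow i)⟩
    have hinj : Function.Injective fun i => E.param (z i) := by
      intro i j h
      by_contra hij
      exact hne i j hij (E.param_injective h)
    refine ⟨⟨fun i => E.param (z i), hcosph.affineIndependent le_rfl hinj⟩, ⟨?_, ?_⟩, hpow⟩
    · intro i
      exact (E.param_mem_curve_iff _).mpr (hz1 i)
    · intro i j hij
      exact (htan (hz1 i) (hz1 j) (hne i j hij)).mpr (hchord i j hij)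

/-! ### Inverting a triangle -/

lemma Affine.Triangle.affineSpan_eq_top (T : Affine.Triangle ℝ ℂ) :
    affineSpan ℝ (Set.range T.points) = ⊤ := by
  rw [T.independent.affineSpan_eq_top_iff_card_eq_finrank_add_one]
  simp [Complex.finrank_real_complex]

lemma Affine.Triangle.circumcenter_circumradius_eq_of_dist_eq (T : Affine.Triangle ℝ ℂ)
    {X : ℂ} {R : ℝ} (h : ∀ i, dist (T.points i) X = R) :
    T.circumcenter = X ∧ T.circumradius = R := by
  have hX : X ∈ affineSpan ℝ (Set.range T.points) := by
    rw [T.affineSpan_eq_top]; exact AffineSubspace.mem_top ℝ ℂ X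
  exact ⟨(T.eq_circumcenter_of_dist_eq hX h).symm, (T.eq_circumradius_of_dist_eq hX h).symm⟩

/-- A nondegenerate triangle is not contained in a line `Re (z conj n) = c`. -/
lemma Affine.Triangle.not_forall_mem_line (T : Affine.Triangle ℝ ℂ) {n : ℂ} (hn : n ≠ 0) (c : ℝ)
    (h : ∀ i, (T.points i * conj n).re = c) : False := by
  have hcol : Collinear ℝ (Set.range T.points) := by
    rw [collinear_iff_of_mem (Set.mem_range_self (0 : Fin 3))]
    refine ⟨Complex.I * n, ?_⟩
    rintro _ ⟨i, rfl⟩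
    refine ⟨((T.points i - T.points 0) * conj n).im / Complex.normSq n, ?_⟩
    have hre : ((T.points i - T.points 0) * conj n).re = 0 := by
      rw [sub_mul, Complex.sub_re, h, h, sub_self]
    have hnc : n * conj n ≠ 0 := by simpa using hn
    have him : (T.points i - T.points 0) * conj n =
        ((T.points i - T.points 0) * conj n).im * Complex.I := by
      apply Complex.ext
      · rw [hre]; simp
      · simp
    rw [Complex.real_smul, vadd_eq_add, Complex.ofReal_div, ← Complex.mul_conj]
    rw [← sub_eq_iff_eq_add, div_mul_eq_mul_div, eq_div_iff hnc]
    linear_combination n * him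
  exact (affineIndependent_iff_not_collinear.mp T.independent) hcol

lemma inversion_eq_complex (O : ℂ) (r : ℝ) (Z : ℂ) :
    EuclideanGeometry.inversion O r Z = O + (r ^ 2 / Complex.normSq (Z - O) : ℝ) * (Z - O) := by
  rw [EuclideanGeometry.inversion, Complex.dist_eq, vsub_eq_sub, vadd_eq_add, Complex.real_smul,
    div_pow, Complex.sq_norm, add_comm]

/-- The image of a circle of centre `X` and radius `R` under an inversion is a circle of centre
`O + (r² / p) (X - O)`, where `p = |O - X|² - R²` is the power of the centre `O`. -/
lemma dist_inversion_eq {O X Z : ℂ} {r R p : ℝ} (hp : p = Complex.normSq (O - X) - R ^ 2)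
    (hp0 : p ≠ 0) (hZ : dist Z X = R) :
    dist (EuclideanGeometry.inversion O r Z) (O + (r ^ 2 / p : ℝ) * (X - O)) =
      |r ^ 2 / p| * R := by
  have hZO : Z - O ≠ 0 := by
    intro h
    apply hp0
    rw [sub_eq_zero] at h
    rw [hp, ← hZ, h, Complex.dist_eq, Complex.sq_norm, sub_self]
  set v := Z - O with hv
  set x := X - O with hx
  have hR : R ^ 2 = Complex.normSq (v - x) := by
    rw [← hZ, Complex.dist_eq, Complex.sq_norm, hv, hx]; congr 1; ring
  have hpx : p = Complex.normSq x - R ^ 2 := by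
    rw [hp, ← Complex.normSq_neg, hx]; congr 2; ring
  have hn : Complex.normSq v ≠ 0 := (Complex.normSq_pos.mpr hZO).ne'
  have hR0 : 0 ≤ R := hZ ▸ dist_nonneg
  rw [inversion_eq_complex, Complex.dist_eq, add_sub_add_left_eq_sub, ← hv,
    ← sq_eq_sq₀ (norm_nonneg _) (by positivity), mul_pow, sq_abs, hR, Complex.sq_norm]
  have hp2 : p = 2 * (v.re * x.re + v.im * x.im) - Complex.normSq v := by
    rw [hpx, hR]; simp only [Complex.normSq_apply, Complex.sub_re, Complex.sub_im]; ring
  have hN : Complex.normSq v = v.re ^ 2 + v.im ^ 2 := by rw [Complex.normSq_apply]; ring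
  have ha : r ^ 2 / Complex.normSq v * Complex.normSq v = r ^ 2 := div_mul_cancel₀ _ hn
  have hb : r ^ 2 / p * p = r ^ 2 := div_mul_cancel₀ _ hp0
  generalize r ^ 2 / Complex.normSq v = a at *
  generalize r ^ 2 / p = b at *
  generalize Complex.normSq v = N at *
  simp only [Complex.normSq_apply, Complex.sub_re, Complex.sub_im, Complex.re_ofReal_mul,
    Complex.im_ofReal_mul]
  linear_combination (a - b) * (ha - hb) + (a * b - b ^ 2) * hp2 - (a ^ 2 - b ^ 2) * hN

/-- An inversion centred at a point of a circle maps the rest of that circle into a line. -/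
lemma inversion_mem_line {O X Z : ℂ} {r R : ℝ} (hp : Complex.normSq (O - X) - R ^ 2 = 0)
    (hZ : dist Z X = R) (hZO : Z ≠ O) :
    (EuclideanGeometry.inversion O r Z * conj (X - O)).re =
      (O * conj (X - O)).re + r ^ 2 / 2 := by
  have hn : Complex.normSq (Z - O) ≠ 0 := (Complex.normSq_pos.mpr (sub_ne_zero.mpr hZO)).ne'
  have h1 : Complex.normSq (Z - O) = 2 * ((Z - O) * conj (X - O)).re := by
    rw [← hZ, Complex.dist_eq, Complex.sq_norm] at hp
    simp [Complex.normSq_apply] at hp ⊢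
    linarith
  rw [inversion_eq_complex, add_mul, mul_assoc, Complex.add_re, Complex.re_ofReal_mul]
  congr 1
  rw [h1] at hn ⊢
  generalize ((Z - O) * conj (X - O)).re = w at *
  have hw : w ≠ 0 := right_ne_zero_of_mul hn
  field_simp

/-- Existence and circumcentre of the inversive triangle, for a triangle with circumcentre `X` and
circumradius `R`. -/
lemma exists_isInversiveTriangle_iff {O : ℂ} {r : ℝ} (hr : 0 < r) {T : Affine.Triangle ℝ ℂ}
    {X : ℂ} {R p : ℝ} (hT : ∀ i, dist (T.points i) X = R)
    (hp : p = Complex.normSq (O - X) - R ^ 2) (Y : ℂ) :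
    (∃ T' : Affine.Triangle ℝ ℂ, IsInversiveTriangle O r T T' ∧ Y = T'.circumcenter) ↔
      p ≠ 0 ∧ Y = O + (r ^ 2 / p : ℝ) * (X - O) := by
  constructor
  · rintro ⟨T', hinv, rfl⟩
    have hp0 : p ≠ 0 := by
      intro h0
      have hline := fun i => inversion_mem_line (r := r) (hp.symm.trans h0) (hT i) (hinv i).1
      refine T'.not_forall_mem_line (n := X - O) ?_ ((O * conj (X - O)).re + r ^ 2 / 2) ?_
      · intro hXO
        have := hline 0
        rw [hXO] at this
        simp only [map_zero, mul_zero, Complex.zero_re, zero_add] at this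
        have : 0 < r ^ 2 := by positivity
        linarith
      · intro i
        rw [(hinv i).2, hline i]
    refine ⟨hp0, (T'.circumcenter_circumradius_eq_of_dist_eq (R := |r ^ 2 / p| * R) fun i => ?_).1⟩
    rw [(hinv i).2, dist_inversion_eq hp hp0 (hT i)]
  · rintro ⟨hp0, rfl⟩
    have hdist := fun i => dist_inversion_eq (r := r) hp hp0 (hT i)
    have hcosph : EuclideanGeometry.Cospherical
        (Set.range fun i => EuclideanGeometry.inversion O r (T.points i)) :=
      ⟨_, _, Set.forall_mem_range.mpr hdist⟩
    have hinj : Function.Injective fun i => EuclideanGeometry.inversion O r (T.points i) :=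
      (EuclideanGeometry.inversion_injective O hr.ne').comp T.independent.injective
    refine ⟨⟨_, hcosph.affineIndependent le_rfl hinj⟩, fun i => ⟨?_, rfl⟩, ?_⟩
    · intro h
      apply hp0
      rw [hp, ← hT i, h, Complex.dist_eq, Complex.sq_norm, sub_self]
    · exact (Affine.Triangle.circumcenter_circumradius_eq_of_dist_eq _ hdist).1.symm

end

/-! ### The locus of the inversive circumcentre -/

theorem mainTheorem2 (E Ec : PlaneEllipse) (hE : ¬ E.IsCircle) (hnest : Ec.NestedIn E)
    (hfam : (ponceletFamily E Ec).Nonempty) (O : ℂ) (r : ℝ) (hr : 0 < r) :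
    (O ∈ interior (circumcircleRegion E Ec)ᶜ →
      IsEllipse (inversiveCircumcenterLocus E Ec O r)) ∧
    (O ∈ interior (circumcircleRegion E Ec) →
      IsHyperbola (inversiveCircumcenterLocus E Ec O r)) ∧
    (O ∈ frontier (circumcircleRegion E Ec) →
      IsParabola (inversiveCircumcenterLocus E Ec O r)) := by
  obtain ⟨Q, c₀, A, B, q, hq, hAB, hnet₁, hnet₂⟩ := exists_circumcircle_net hE hnest hfam
  have hpow : ∀ Z l, netPower q c₀ A B (Z - Q) l =
      Complex.normSq (Z - (Q + ellipsePoint c₀ A B l)) -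
        √(Complex.normSq (ellipsePoint c₀ A B l) - q) ^ 2 := by
    intro Z l
    rw [Real.sq_sqrt (by linarith [Complex.normSq_nonneg (ellipsePoint c₀ A B l)]), netPower]
    simp [Complex.normSq_apply]; ring
  have hregion : circumcircleRegion E Ec = Homeomorph.subRight Q ⁻¹' netRegion q c₀ A B := by
    ext Z
    change _ ↔ netDisc q c₀ A B (Z - Q) ≤ 0
    rw [← exists_netPower_eq_zero_iff]
    have hmem : ∀ (T : Affine.Triangle ℝ ℂ) (l : ℂ),
        (∀ i, netPower q c₀ A B (T.points i - Q) l = 0) →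
        (Z ∈ T.circumsphere ↔ netPower q c₀ A B (Z - Q) l = 0) := by
      intro T l h
      simp only [netPower_sub_eq_zero_iff hq] at h ⊢
      obtain ⟨h1, h2⟩ := T.circumcenter_circumradius_eq_of_dist_eq h
      rw [EuclideanGeometry.mem_sphere, ← h1, ← h2]
      rfl
    constructor
    · rintro ⟨T, hT, hZ⟩
      obtain ⟨l, hl, h⟩ := hnet₁ T hT
      exact ⟨l, hl, (hmem T l h).mp hZ⟩
    · rintro ⟨l, hl, hZ⟩
      obtain ⟨T, hT, h⟩ := hnet₂ l hl
      exact ⟨T, hT, (hmem T l h).mpr hZ⟩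
  have hlocus : inversiveCircumcenterLocus E Ec O r =
      {X | ∃ l, ‖l‖ = 1 ∧ netPower q c₀ A B (O - Q) l ≠ 0 ∧
        X = O + (r ^ 2 : ℝ) * ((ellipsePoint c₀ A B l - (O - Q)) /
          netPower q c₀ A B (O - Q) l)} := by
    ext X
    have hinv : ∀ (T : Affine.Triangle ℝ ℂ) (l : ℂ),
        (∀ i, netPower q c₀ A B (T.points i - Q) l = 0) →
        ((∃ T' : Affine.Triangle ℝ ℂ, IsInversiveTriangle O r T T' ∧ X = T'.circumcenter) ↔
          netPower q c₀ A B (O - Q) l ≠ 0 ∧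
            X = O + (r ^ 2 : ℝ) * ((ellipsePoint c₀ A B l - (O - Q)) /
              netPower q c₀ A B (O - Q) l)) := by
      intro T l h
      simp only [netPower_sub_eq_zero_iff hq] at h
      rw [exists_isInversiveTriangle_iff hr h (hpow O l)]
      apply and_congr_right
      intro _
      rw [Complex.ofReal_div, show Q + ellipsePoint c₀ A B l - O =
        ellipsePoint c₀ A B l - (O - Q) by ring, div_mul_eq_mul_div, mul_div_assoc]
    constructor
    · rintro ⟨T, hT, hX⟩
      obtain ⟨l, hl, h⟩ := hnet₁ T hT
      exact ⟨l, hl, (hinv T l h).mp hX⟩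
    · rintro ⟨l, hl, hX⟩
      obtain ⟨T, hT, h⟩ := hnet₂ l hl
      exact ⟨T, hT, (hinv T l h).mpr hX⟩
  obtain ⟨h₁, h₂, h₃⟩ := locus_trichotomy hq c₀ hAB (O - Q) O (by positivity : 0 < r ^ 2) hlocus
  refine ⟨fun h => h₁ ?_, fun h => h₂ ?_, fun h => h₃ ?_⟩
  · have hO := interior_subset h
    rw [hregion] at hO
    exact not_le.mp hO
  · rw [hregion, ← Homeomorph.preimage_interior] at h
    exact netDisc_neg_of_mem_interior hq h
  · rw [hregion, ← Homeomorph.preimage_frontier] at h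
    exact netDisc_eq_zero_of_mem_frontier h
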